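/- **Setting.** In the Lipschitz multi-armed bandit problem there is a nonempty metric space $(X,L)$ of diameter at most $1$, and every strategy $x\in X$ has a payoff distribution $\mathcal D(x)$ supported in $[0,1]$ with expectation $\mu(x)$, where $|\mu(x)-\mu(y)|\le L(x,y)$ for all $x,y\in X$. An algorithm knows $(X,L)$ (it accesses it through a covering oracle, which is given a finite collection of open balls and either declares that they cover $X$ or outputs an uncovered point), but it does not know $\mathcal D$ or $\mu$. In each round it chooses a strategy $x$ on the basis of its past observations and receives an independent sample from $\mathcal D(x)$. Let $\mu^*=\sup_{x}\mu(x)$. The regret $R(t)$ is $t\mu^*$ minus the expected total payoff in the first $t$ rounds. For $c>0$, the $c$-zooming dimension of the instance is the smallest $d$ such that for every $r\in(0,1]$ the set $\{x:\ r/2<\mu^*-\mu(x)\le r\}$ can be covered by at most $c\,r^{-d}$ sets of diameter at most $r/8$. **The algorithm.** Given $\kappa>0$ and positive integers $\ell_0,\ell_1,\ell_2,\dots$, the zooming algorithm runs in phases $i=0,1,2,\dots$ of $\ell_i$ rounds. Put $\alpha_i=\kappa\log_2\ell_i$. In round $t$ of phase $i$, let $n_t(v)$ be the number of times $v$ has been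 played earlier in this phase, let $\mu_t(v)$ be the corresponding average reward ($0$ if $n_t(v)=0$), and let $$r_t(v)=\frac{\alpha_i}{1+n_t(v)}+\sqrt{\alpha_i\,\frac{1-\mu_t(v)}{1+n_t(v)}} .$$ In the beginning of each phase no strategy is active. In each round the algorithm first asks the oracle whether the open balls of radius $r_t(v)$ around the active strategies $v$ cover $X$, and if they do not, it makes the uncovered strategy output by the oracle active. Then it plays an active strategy with the maximal index $\mu_t(v)+2r_t(v)$, breaking ties arbitrarily. **Goodness.** For $\beta\ge 0$, an algorithm is $\beta$-good with constant $c_0$ on an instance if for every $c>0$, every real $d$ that is at least the $c$-zooming dimension, and every $t\ge 2$: (a) if $d+\beta>1$, then $R(t)\le (c\,c_0\log^2 t)^{1/(d+\beta)}\;t^{\,1-1/(d+\beta)}$; (b) if $d+\beta\le 1$, then $R(t)\le c\,c_0\log^2 t$. **Theorem.** There are absolute constants $\kappa,c_0>0$ and an absolute sequence of phase lengths $\ell_i\ge1$ such that for every metric space as above, every covering oracle and every tie-breaking rule, the zooming algorithm with the relative confidence radius $r_t(v)$ is $2$-good with constant $c_0$ on every instance, and $1$-good with constant $c_0$ on every instance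 with $\mu^*=1$. -/

import Mathlib

open MeasureTheory Set

universe u v

namespace LipschitzBandit

/-- An instance of the Lipschitz multi-armed bandit problem on the metric space `X` (whose metric
is the similarity function): every strategy `x` carries a payoff distribution supported in `[0,1]`
with expectation `payoff x`, and the payoff function is Lipschitz with constant `1`. -/
structure Instance (X : Type u) [MetricSpace X] where
  payoff : X → ℝ
  payoffDist : X → Measure ℝ
  isProbabilityMeasure : ∀ x, IsProbabilityMeasure (payoffDist x)
  support_subset : ∀ x, ∀ᵐ y ∂(payoffDist x), y ∈ Icc (0 : ℝ) 1
  expectation_eq : ∀ x, ∫ y, y ∂(payoffDist x) = payoff x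
  lipschitz : ∀ x y, |payoff x - payoff y| ≤ dist x y

section Instance

variable {X : Type u} [MetricSpace X]

/-- The maximal expected reward (a supremum, possibly not attained). -/
noncomputable def Instance.maxReward (P : Instance X) : ℝ := ⨆ x, P.payoff x

/-- The strategies whose payoff falls short of the maximum by more than `r / 2` and at most `r`. -/
def Instance.layer (P : Instance X) (r : ℝ) : Set X :=
  {x | r / 2 < P.maxReward - P.payoff x ∧ P.maxReward - P.payoff x ≤ r}

/-- For every `r ∈ (0,1]` the layer at `r` can be covered by at most `c r^{-d}` sets of diameter
at most `r / 8`. -/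
def Instance.ZoomingCover (P : Instance X) (c d : ℝ) : Prop :=
  ∀ r ∈ Ioc (0 : ℝ) 1, ∃ n : ℕ, (n : ℝ) ≤ c * r ^ (-d) ∧
    ∃ S : Fin n → Set X, (∀ i, Metric.ediam (S i) ≤ ENNReal.ofReal (r / 8)) ∧
      P.layer r ⊆ ⋃ i, S i

/-- The `c`-zooming dimension: the smallest `d` with `ZoomingCover c d`. It is `⊤` if there is no
such `d`, and `⊥` if every real `d` is admissible (for instance if all strategies are optimal). -/
noncomputable def Instance.zoomingDim (P : Instance X) (c : ℝ) : EReal :=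
  sInf {e : EReal | ∃ d : ℝ, P.ZoomingCover c d ∧ e = (d : EReal)}

end Instance

/-- A bandit algorithm as a decision rule: it maps the list of past observations
(strategy, reward), the most recent one first, to the strategy that is played next. -/
abbrev DecisionRule (X : Type u) : Type u := List (X × ℝ) → X

/-- The list of the observations made in the rounds `0, …, t - 1`, the most recent one first. -/
def history {X : Type u} {Ω : Type v} (x : ℕ → Ω → X) (y : ℕ → Ω → ℝ) :
    ℕ → Ω → List (X × ℝ)
  | 0, _ => []
  | t + 1, ω => (x t ω, y t ω) :: history x y t ω

/-- The random sequences `x` (strategies played) and `y` (rewards received) on the probability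
space `(Ω, Pr)` arise from running the decision rule `A` on the instance `P`: in round `t` the
rule plays `x t` on the basis of the past observations and then receives `y t`, which,
conditionally on everything that happened before it is drawn, has the payoff distribution of the
strategy `x t`. -/
structure IsRun {X : Type u} [MetricSpace X] (P : Instance X) (A : DecisionRule X)
    {Ω : Type v} [mΩ : MeasurableSpace Ω] (Pr : Measure Ω) (ℱ : Filtration ℕ mΩ)
    (x : ℕ → Ω → X) (y : ℕ → Ω → ℝ) : Prop where
  play : ∀ t ω, x t ω = A (history x y t ω)
  stronglyMeasurable_play : ∀ t, StronglyMeasurable[ℱ t] (x t)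
  measurable_reward : ∀ t, Measurable[ℱ (t + 1)] (y t)
  condLaw_reward : ∀ t, ∀ B : Set ℝ, MeasurableSet B →
    Pr[(y t ⁻¹' B).indicator (fun _ => (1 : ℝ)) | ℱ t]
      =ᵐ[Pr] fun ω => (P.payoffDist (x t ω)).real B

/-- The regret after `t` rounds: `t` times the maximal expected reward, minus the expected total
payoff collected in these rounds. -/
noncomputable def Instance.regret {X : Type u} [MetricSpace X] (P : Instance X)
    {Ω : Type v} [MeasurableSpace Ω] (Pr : Measure Ω) (y : ℕ → Ω → ℝ) (t : ℕ) : ℝ :=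
  t * P.maxReward - ∫ ω, ∑ s ∈ Finset.range t, y s ω ∂Pr

/-- The decision rule `A` satisfies on the instance `P` the regret guarantees that define a
`β`-good algorithm, with the constant `c₀`. A bound is asked for every real `d` that is at least
the `c`-zooming dimension. -/
def IsGoodOn {X : Type u} [MetricSpace X] (A : DecisionRule X) (P : Instance X) (β c₀ : ℝ) :
    Prop :=
  ∀ c d : ℝ, 0 < c → P.zoomingDim c ≤ (d : EReal) →
    ∀ (Ω : Type v) [mΩ : MeasurableSpace Ω] (Pr : Measure Ω) [IsProbabilityMeasure Pr]
      (ℱ : Filtration ℕ mΩ) (x : ℕ → Ω → X) (y : ℕ → Ω → ℝ), IsRun P A Pr ℱ x y →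
      ∀ t : ℕ, 2 ≤ t →
        (1 < d + β →
          P.regret Pr y t ≤
            (c * c₀ * Real.log t ^ 2) ^ (1 / (d + β)) * (t : ℝ) ^ (1 - 1 / (d + β))) ∧
        (d + β ≤ 1 → P.regret Pr y t ≤ c * c₀ * Real.log t ^ 2)

/-- A covering oracle for `X`: given a finite collection of open balls (centre, radius), it either
declares that they cover `X` (answer `none`) or outputs an uncovered point. -/
structure CoveringOracle (X : Type u) [MetricSpace X] where
  query : Finset (X × ℝ) → Option X
  covers_of_none : ∀ B, query B = none → ∀ p, ∃ b ∈ B, p ∈ Metric.ball b.1 b.2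
  uncovered_of_some : ∀ B p, query B = some p → ∀ b ∈ B, p ∉ Metric.ball b.1 b.2

/-- A way of breaking ties: it selects an element of any nonempty finite set of strategies,
possibly depending on the past observations. -/
structure TieBreak (X : Type u) where
  choose : List (X × ℝ) → Finset X → X
  choose_mem : ∀ h S, S.Nonempty → choose h S ∈ S

section Phases

/-- The first round of phase `i`, if phase `j` lasts `len j` rounds (rounds and phases are counted
from `0`). -/
def phaseStart (len : ℕ → ℕ) (i : ℕ) : ℕ := ∑ j ∈ Finset.range i, len j

/-- The phase to which round `t` belongs: the last phase that starts no later than in round `t`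
(phase lengths are positive, so that phase `i` starts in round `i` at the earliest). -/
def phaseOf (len : ℕ → ℕ) (t : ℕ) : ℕ := Nat.findGreatest (fun i => phaseStart len i ≤ t) t

/-- The number of rounds of the current phase that precede round `t`. -/
def elapsed (len : ℕ → ℕ) (t : ℕ) : ℕ := t - phaseStart len (phaseOf len t)

end Phases

section Zooming

open scoped Classical

variable {X : Type u} [MetricSpace X]

/-- The observations of the current phase. -/
def currentPhase (len : ℕ → ℕ) (h : List (X × ℝ)) : List (X × ℝ) :=
  h.take (elapsed len h.length)

/-- The rewards received from the strategy `v` in the current phase. -/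
noncomputable def rewardsOf (len : ℕ → ℕ) (h : List (X × ℝ)) (v : X) : List ℝ :=
  ((currentPhase len h).filter (fun o => o.1 = v)).map Prod.snd

/-- How often the strategy `v` has been played in the current phase. -/
noncomputable def plays (len : ℕ → ℕ) (h : List (X × ℝ)) (v : X) : ℕ :=
  (rewardsOf len h v).length

/-- The average reward of the strategy `v` in the current phase; it is `0` if `v` has not been
played in this phase. -/
noncomputable def avgReward (len : ℕ → ℕ) (h : List (X × ℝ)) (v : X) : ℝ :=
  (rewardsOf len h v).sum / plays len h v

/-- The parameter of the confidence radius in round `t`: `κ` times the binary logarithm of the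
length of the current phase. -/
noncomputable def phaseParam (κ : ℝ) (len : ℕ → ℕ) (t : ℕ) : ℝ :=
  κ * Real.logb 2 (len (phaseOf len t))

/-- The relative confidence radius `α / (1 + n) + √(α (1 - m) / (1 + n))`. -/
noncomputable def relativeRadius (α n m : ℝ) : ℝ :=
  α / (1 + n) + Real.sqrt (α * ((1 - m) / (1 + n)))

/-- The confidence radius of the strategy `v` after the observations `h`. -/
noncomputable def radius (κ : ℝ) (len : ℕ → ℕ) (h : List (X × ℝ)) (v : X) : ℝ :=
  relativeRadius (phaseParam κ len h.length) (plays len h v) (avgReward len h v)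

/-- The index of the strategy `v` after the observations `h`. -/
noncomputable def index (κ : ℝ) (len : ℕ → ℕ) (h : List (X × ℝ)) (v : X) : ℝ :=
  avgReward len h v + 2 * radius κ len h v

/-- The activation step: ask the oracle whether the confidence balls of the active strategies `S`
cover `X`, and if not, activate the uncovered strategy that it outputs. -/
noncomputable def activate (κ : ℝ) (len : ℕ → ℕ) (O : CoveringOracle X) (h : List (X × ℝ))
    (S : Finset X) : Finset X :=
  match O.query (S.image fun v => (v, radius κ len h v)) with
  | none => S
  | some p => insert p S

/-- The set of active strategies from which the one played right after the observations `h` is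
taken. No strategy is active in the beginning of a phase; every round starts with one activation
step. -/
noncomputable def active (κ : ℝ) (len : ℕ → ℕ) (O : CoveringOracle X) :
    List (X × ℝ) → Finset X
  | [] => activate κ len O [] ∅
  | o :: h => activate κ len O (o :: h)
      (if elapsed len (o :: h).length = 0 then ∅ else active κ len O h)

/-- The zooming algorithm with the relative confidence radius: in every round, perform the
activation step and then play an active strategy with the maximal index. -/
noncomputable def zoomingRule (κ : ℝ) (len : ℕ → ℕ) (O : CoveringOracle X) (τ : TieBreak X) :
    DecisionRule X := fun h =>
  τ.choose h ((active κ len O h).filter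
    fun v => ∀ w ∈ active κ len O h, index κ len h w ≤ index κ len h v)

end Zooming

end LipschitzBandit

/-! Why the relative radius is valid: a loss `1 - y` in [0,1] has second moment at most its mean 1 -
μ. A Bernstein-type supermartingale therefore bounds the deviation after n plays by the order of √(a
n (1 - μ)) + a, and the unknown 1 - μ can be replaced by its empirical value
(`abs_sub_le_relativeRadius`). The union bound runs over rounds, not strategies: a strategy is
represented by the round of its first play in the phase, so the cardinality of X plays no role.

Outside the deviation event a phase is clean, and a strategy of gap Δ satisfies two bounds. The
confidence balls cover X, so optimism forces Δ ≤ 3r whenever the strategy is played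
(`IsClean.gap_le`); solved for the number of plays, this allows at most the order of α (1 - μ) / Δ²
of them. That is α / Δ² in general and α / Δ if μ* = 1, since then 1 - μ = Δ; hence β = 2 or β = 1
(`Instance.GapCondition`). Moreover, as plays happen only while Δ ≤ 3r, the radius never drops below
Δ / 4 (`IsClean.gap_div_four_le`). New strategies are activated outside the balls of the active
ones, so active strategies of the layer at ρ are more than ρ / 8 apart and a covering set contains
at most one of them. A clean phase thus plays the layer at most the order of c ρ^(-d) · α ρ^(-β)
times (`IsClean.card_layer_le`).

With phase lengths 2^(2^i) the parameters α form a geometric sequence, so all phases up to round t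
cost one factor log t; the dyadic scales between δ and 1 cost another. Gaps up to δ / 2 cost at most
δ t / 2. For e = d + β > 1 the two contributions balance at δ = (c c₀ log² t / t)^(1/e); for e ≤ 1
the choice δ = 1 / t suffices. -/

namespace LipschitzBandit

/-! ### Conditional expectation of the rewards -/

/-- The lower approximation of the identity of `[0,1]` by multiples of `1 / K`, as a combination of
indicator functions. -/
noncomputable def stepApprox (K : ℕ) (z : ℝ) : ℝ :=
  ∑ k ∈ Finset.range K, (1 / (K : ℝ)) * (Ici (((k : ℝ) + 1) / K)).indicator (fun _ => (1 : ℝ)) z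

theorem stepApprox_bounds {K : ℕ} (hK : 0 < K) {z : ℝ} (hz : z ∈ Icc (0 : ℝ) 1) :
    stepApprox K z ≤ z ∧ z ≤ stepApprox K z + 1 / K := by
  have hK' : (0 : ℝ) < K := by exact_mod_cast hK
  have hKz : 0 ≤ K * z := mul_nonneg hK'.le hz.1
  have h1 : stepApprox K z = (⌊K * z⌋₊ : ℝ) / K := by
    have hF : ⌊K * z⌋₊ ≤ K := by
      apply Nat.floor_le_of_le
      nlinarith [hz.2]
    have h2 : ∀ k : ℕ, (Ici (((k : ℝ) + 1) / K)).indicator (fun _ => (1 : ℝ)) z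
        = if k < ⌊K * z⌋₊ then 1 else 0 := by
      intro k
      have : z ∈ Ici (((k : ℝ) + 1) / K) ↔ k < ⌊K * z⌋₊ := by
        rw [← Nat.succ_le_iff, Nat.le_floor_iff hKz, mem_Ici, div_le_iff₀ hK', mul_comm z]
        push_cast; rfl
      by_cases h : k < ⌊K * z⌋₊
      · rw [indicator_of_mem (this.2 h), if_pos h]
      · rw [indicator_of_notMem (fun h' => h (this.1 h')), if_neg h]
    have h3 : (Finset.range K).filter (fun k => k < ⌊K * z⌋₊) = Finset.range ⌊K * z⌋₊ := by
      ext k; simp only [Finset.mem_filter, Finset.mem_range]; omega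
    unfold stepApprox
    rw [← Finset.mul_sum, Finset.sum_congr rfl fun k _ => h2 k, Finset.sum_boole, h3,
      Finset.card_range]
    ring
  rw [h1]
  constructor
  · rw [div_le_iff₀ hK', mul_comm z]; exact Nat.floor_le hKz
  · rw [← add_div, le_div_iff₀ hK', mul_comm z]; exact (Nat.lt_floor_add_one _).le

theorem measurable_stepApprox (K : ℕ) : Measurable (stepApprox K) := by
  unfold stepApprox
  refine Finset.measurable_sum _ fun k _ => ?_
  exact (measurable_const.indicator measurableSet_Ici).const_mul _

section Instance

variable {X : Type u} [MetricSpace X] (P : Instance X)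

theorem Instance.integrable_id (x : X) : Integrable (fun z : ℝ => z) (P.payoffDist x) := by
  have := P.isProbabilityMeasure x
  refine Integrable.of_bound measurable_id.aestronglyMeasurable 1 ?_
  filter_upwards [P.support_subset x] with z hz
  simpa [abs_of_nonneg hz.1] using hz.2

theorem Instance.payoff_mem (x : X) : P.payoff x ∈ Icc (0 : ℝ) 1 := by
  have := P.isProbabilityMeasure x
  rw [← P.expectation_eq x]
  constructor
  · exact integral_nonneg_of_ae ((P.support_subset x).mono fun z hz => hz.1)
  · calc ∫ z, z ∂(P.payoffDist x) ≤ ∫ _, (1 : ℝ) ∂(P.payoffDist x) :=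
        integral_mono_ae (P.integrable_id x) (integrable_const _)
          ((P.support_subset x).mono fun z hz => hz.2)
      _ = 1 := by simp

theorem Instance.bddAbove_payoff : BddAbove (range P.payoff) :=
  ⟨1, by rintro _ ⟨x, rfl⟩; exact (P.payoff_mem x).2⟩

theorem Instance.payoff_le (x : X) : P.payoff x ≤ P.maxReward := le_ciSup P.bddAbove_payoff x

theorem Instance.maxReward_le [Nonempty X] : P.maxReward ≤ 1 :=
  ciSup_le fun x => (P.payoff_mem x).2

theorem Instance.continuous_payoff : Continuous P.payoff :=
  (LipschitzWith.of_dist_le_mul (K := 1) fun x y => by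
    simpa [Real.dist_eq] using P.lipschitz x y).continuous

theorem Instance.stepApprox_integral (K : ℕ) (x : X) :
    ∫ z, stepApprox K z ∂(P.payoffDist x)
      = ∑ k ∈ Finset.range K, (1 / (K : ℝ)) * (P.payoffDist x).real (Ici (((k : ℝ) + 1) / K)) := by
  have := P.isProbabilityMeasure x
  unfold stepApprox
  rw [integral_finsetSum]
  · refine Finset.sum_congr rfl fun k _ => ?_
    rw [integral_const_mul, integral_indicator_const _ measurableSet_Ici]; simp
  · intro k _
    exact ((integrable_const _).indicator measurableSet_Ici).const_mul _

theorem Instance.stepApprox_integral_bounds {K : ℕ} (hK : 0 < K) (x : X) :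
    ∫ z, stepApprox K z ∂(P.payoffDist x) ≤ P.payoff x ∧
      P.payoff x ≤ ∫ z, stepApprox K z ∂(P.payoffDist x) + 1 / K := by
  have := P.isProbabilityMeasure x
  have hint : Integrable (stepApprox K) (P.payoffDist x) := by
    refine Integrable.of_bound (measurable_stepApprox K).aestronglyMeasurable 2 ?_
    filter_upwards [P.support_subset x] with z hz
    obtain ⟨h1, h2⟩ := stepApprox_bounds hK hz
    have : 1 / (K : ℝ) ≤ 1 := by
      rw [div_le_one (by exact_mod_cast hK)]; exact_mod_cast hK
    rw [Real.norm_eq_abs, abs_le]; constructor <;> linarith [hz.1, hz.2]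
  rw [← P.expectation_eq x]
  constructor
  · exact integral_mono_ae hint (P.integrable_id x)
      ((P.support_subset x).mono fun z hz => (stepApprox_bounds hK hz).1)
  · calc ∫ z, z ∂(P.payoffDist x) ≤ ∫ z, (stepApprox K z + 1 / K) ∂(P.payoffDist x) :=
        integral_mono_ae (P.integrable_id x) (hint.add (integrable_const _))
          ((P.support_subset x).mono fun z hz => (stepApprox_bounds hK hz).2)
      _ = _ := by rw [integral_add hint (integrable_const _)]; simp

end Instance

section Run

variable {X : Type u} [MetricSpace X] {P : Instance X} {A : DecisionRule X}
  {Ω : Type v} [mΩ : MeasurableSpace Ω] {Pr : Measure Ω}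
  {ℱ : Filtration ℕ mΩ} {x : ℕ → Ω → X} {y : ℕ → Ω → ℝ}

theorem IsRun.measurable (h : IsRun P A Pr ℱ x y) (t : ℕ) : Measurable (y t) :=
  (h.measurable_reward t).mono (ℱ.le _) le_rfl

theorem IsRun.measurable_payoff (h : IsRun P A Pr ℱ x y) (t : ℕ) :
    StronglyMeasurable[ℱ t] fun ω => P.payoff (x t ω) :=
  P.continuous_payoff.comp_stronglyMeasurable (h.stronglyMeasurable_play t)

variable [IsProbabilityMeasure Pr]

theorem IsRun.reward_mem (h : IsRun P A Pr ℱ x y) (t : ℕ) :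
    ∀ᵐ ω ∂Pr, y t ω ∈ Icc (0 : ℝ) 1 := by
  have h1 := h.condLaw_reward t (Icc 0 1) measurableSet_Icc
  have hm : MeasurableSet (y t ⁻¹' Icc 0 1) := h.measurable t measurableSet_Icc
  have h2 : ∫ ω, (y t ⁻¹' Icc (0 : ℝ) 1).indicator (fun _ => (1 : ℝ)) ω ∂Pr = 1 := by
    rw [← integral_condExp (ℱ.le t), integral_congr_ae h1]
    have : ∀ ω, (P.payoffDist (x t ω)).real (Icc (0 : ℝ) 1) = 1 := by
      intro ω
      have := P.isProbabilityMeasure (x t ω)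
      have h3 : (P.payoffDist (x t ω)) (Icc (0 : ℝ) 1) = 1 :=
        (mem_ae_iff_prob_eq_one measurableSet_Icc).1 (P.support_subset _)
      simp [measureReal_def, h3]
    simp [this]
  rw [integral_indicator_const _ hm] at h2
  have h4 : Pr (y t ⁻¹' Icc (0 : ℝ) 1) = 1 := by
    rw [smul_eq_mul, mul_one, measureReal_def] at h2
    rwa [ENNReal.toReal_eq_one_iff] at h2
  exact (mem_ae_iff_prob_eq_one hm).2 h4

theorem IsRun.integrable (h : IsRun P A Pr ℱ x y) (t : ℕ) : Integrable (y t) Pr := by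
  refine Integrable.of_bound (h.measurable t).aestronglyMeasurable 1 ?_
  filter_upwards [h.reward_mem t] with z hz
  rw [Real.norm_eq_abs, abs_of_nonneg hz.1]; exact hz.2

/-- A run prescribes only the conditional probabilities of Borel sets. Step functions are finite
combinations of indicators and approximate the identity of [0,1] within 1 / K, so the conditional
mean differs from the payoff by at most 1 / K, for every K. -/
theorem IsRun.condExp_reward (h : IsRun P A Pr ℱ x y) (t : ℕ) :
    Pr[y t | ℱ t] =ᵐ[Pr] fun ω => P.payoff (x t ω) := by
  have hint : ∀ K : ℕ, ∀ k ∈ Finset.range K, Integrable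
      (fun ω => (1 / (K : ℝ)) * (Ici (((k : ℝ) + 1) / K)).indicator (fun _ => (1 : ℝ)) (y t ω)) Pr := by
    intro K k _
    refine Integrable.const_mul ?_ _
    exact (integrable_const (1 : ℝ)).indicator (h.measurable t measurableSet_Ici)
  have hint' : ∀ K : ℕ, Integrable (fun ω => stepApprox K (y t ω)) Pr := fun K =>
    integrable_finsetSum _ (hint K)
  have hstep : ∀ K : ℕ, Pr[fun ω => stepApprox K (y t ω) | ℱ t] =ᵐ[Pr]
      fun ω => ∫ z, stepApprox K z ∂(P.payoffDist (x t ω)) := by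
    intro K
    have e1 : (fun ω => stepApprox K (y t ω)) = ∑ k ∈ Finset.range K, (1 / (K : ℝ)) •
        (y t ⁻¹' (Ici (((k : ℝ) + 1) / K))).indicator (fun _ => (1 : ℝ)) := by
      funext ω
      simp only [stepApprox, Finset.sum_apply, Pi.smul_apply, smul_eq_mul]
      rfl
    have e2 : ∀ᵐ ω ∂Pr, ∀ k : ℕ,
        (Pr[(1 / (K : ℝ)) • (y t ⁻¹' (Ici (((k : ℝ) + 1) / K))).indicator (fun _ => (1 : ℝ)) | ℱ t]) ω
          = (1 / (K : ℝ)) * (P.payoffDist (x t ω)).real (Ici (((k : ℝ) + 1) / K)) := by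
      rw [ae_all_iff]
      intro k
      filter_upwards [condExp_smul (μ := Pr) (1 / (K : ℝ))
        ((y t ⁻¹' (Ici (((k : ℝ) + 1) / K))).indicator (fun _ => (1 : ℝ))) (ℱ t),
        h.condLaw_reward t _ (measurableSet_Ici (a := ((k : ℝ) + 1) / K))] with ω h1 h2
      rw [h1, Pi.smul_apply, h2, smul_eq_mul]
    rw [e1]
    filter_upwards [condExp_finsetSum (μ := Pr) (s := Finset.range K) (fun k hk => hint K k hk) (ℱ t), e2]
      with ω h1 h2
    rw [P.stepApprox_integral, ← Finset.sum_congr rfl fun k _ => h2 k]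
    refine Eq.trans ?_ (h1.trans (by simp only [Finset.sum_apply]; rfl))
    rfl
  have hK : ∀ᵐ ω ∂Pr, ∀ K : ℕ, |(Pr[y t | ℱ t]) ω - P.payoff (x t ω)| ≤ 1 / ((K : ℝ) + 1) := by
    rw [ae_all_iff]
    intro K
    have b1 : (fun ω => stepApprox (K + 1) (y t ω)) ≤ᵐ[Pr] y t :=
      (h.reward_mem t).mono fun ω hω => (stepApprox_bounds (Nat.succ_pos K) hω).1
    have b2 : y t ≤ᵐ[Pr] (fun ω => stepApprox (K + 1) (y t ω)) + fun _ => 1 / ((K + 1 : ℕ) : ℝ) :=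
      (h.reward_mem t).mono fun ω hω => (stepApprox_bounds (Nat.succ_pos K) hω).2
    filter_upwards [condExp_mono (m := ℱ t) (hint' (K + 1)) (h.integrable t) b1,
      condExp_mono (m := ℱ t) (h.integrable t) ((hint' (K + 1)).add (integrable_const _)) b2,
      condExp_add (hint' (K + 1)) (integrable_const (1 / ((K + 1 : ℕ) : ℝ))) (ℱ t),
      hstep (K + 1)] with ω h1 h2 h3 h4
    obtain ⟨h5, h6⟩ := P.stepApprox_integral_bounds (Nat.succ_pos K) (x t ω)
    rw [h3, Pi.add_apply, condExp_const (ℱ.le t)] at h2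
    rw [h4] at h1 h2
    push_cast at *
    rw [abs_le]; constructor <;> linarith
  filter_upwards [hK] with ω hω
  have : |(Pr[y t | ℱ t]) ω - P.payoff (x t ω)| ≤ 0 :=
    ge_of_tendsto' tendsto_one_div_add_atTop_nhds_zero_nat hω
  exact sub_eq_zero.1 (abs_nonpos_iff.1 this)

theorem IsRun.integral_mul_reward (h : IsRun P A Pr ℱ x y) (t : ℕ) {g : Ω → ℝ}
    (hg : StronglyMeasurable[ℱ t] g) {C : ℝ} (hC : ∀ᵐ ω ∂Pr, |g ω| ≤ C) :
    ∫ ω, g ω * y t ω ∂Pr = ∫ ω, g ω * P.payoff (x t ω) ∂Pr := by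
  have hi : Integrable (g * y t) Pr :=
    (h.integrable t).bdd_mul (hg.mono (ℱ.le t)).aestronglyMeasurable hC
  have h1 := condExp_mul_of_stronglyMeasurable_left hg hi (h.integrable t)
  calc ∫ ω, g ω * y t ω ∂Pr = ∫ ω, (Pr[g * y t | ℱ t]) ω ∂Pr := (integral_condExp (ℱ.le t)).symm
    _ = _ := integral_congr_ae (h1.trans ((h.condExp_reward t).mono fun ω hω => by
      simp only [Pi.mul_apply, hω]))

end Run

/-! ### Bernstein-type exponential supermartingale -/

theorem exp_mul_le_of_mem_Icc (l : ℝ) {z : ℝ} (hz : z ∈ Icc (0 : ℝ) 1) :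
    Real.exp (l * z) ≤ 1 + (Real.exp l - 1) * z := by
  have h := convexOn_exp.2 (mem_univ (0 : ℝ)) (mem_univ l) (sub_nonneg.2 hz.2) hz.1 (by ring)
  simp only [smul_eq_mul, mul_zero, zero_add, Real.exp_zero] at h
  rw [mul_comm l]
  linarith

/-- For |l| ≤ 1 of either sign, e^l - 1 ≤ l + l². The compensator is thus proportional to the mean
loss q instead of a constant, which is the origin of the factor 1 - μ in the radius. -/
theorem exp_mul_one_add_le {l q : ℝ} (hl : |l| ≤ 1) (hq : 0 ≤ q) :
    Real.exp (-((l + l ^ 2) * q)) * (1 + (Real.exp l - 1) * q) ≤ 1 := by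
  have h1 : Real.exp l - 1 ≤ l + l ^ 2 := by
    have := (abs_le.1 (Real.abs_exp_sub_one_sub_id_le hl)).2
    linarith
  have h2 : 1 + (Real.exp l - 1) * q ≤ Real.exp ((l + l ^ 2) * q) := by
    have := Real.add_one_le_exp ((l + l ^ 2) * q)
    nlinarith
  calc _ ≤ Real.exp (-((l + l ^ 2) * q)) * Real.exp ((l + l ^ 2) * q) :=
        mul_le_mul_of_nonneg_left h2 (Real.exp_pos _).le
    _ = 1 := by rw [← Real.exp_add]; simp

section Run

variable {X : Type u} [MetricSpace X] {P : Instance X} {A : DecisionRule X}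
  {Ω : Type v} [mΩ : MeasurableSpace Ω] {Pr : Measure Ω}
  {ℱ : Filtration ℕ mΩ} {x : ℕ → Ω → X} {y : ℕ → Ω → ℝ}

/-- The exponent of the Bernstein-type supermartingale with parameter `l`: the compensated sum of
the losses `1 - y`, over the rounds before `N` that are selected by `B`. -/
noncomputable def exponent (P : Instance X) (x : ℕ → Ω → X) (y : ℕ → Ω → ℝ) (l : ℝ)
    (B : ℕ → Ω → ℝ) (N : ℕ) (ω : Ω) : ℝ :=
  ∑ w ∈ Finset.range N, B w ω *
    (l * (P.payoff (x w ω) - y w ω) - l ^ 2 * (1 - P.payoff (x w ω)))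

theorem IsRun.stronglyMeasurable_exponent (h : IsRun P A Pr ℱ x y) (l : ℝ) {B : ℕ → Ω → ℝ}
    (hB : ∀ w, StronglyMeasurable[ℱ w] (B w)) (N : ℕ) :
    StronglyMeasurable[ℱ N] (exponent P x y l B N) := by
  unfold exponent
  refine Finset.stronglyMeasurable_fun_sum _ fun w hw => ?_
  have hw' : w + 1 ≤ N := Finset.mem_range.1 hw
  have h1 := (h.measurable_payoff w).mono (ℱ.mono (Nat.le_of_succ_le hw'))
  have h2 := (hB w).mono (ℱ.mono (Nat.le_of_succ_le hw'))
  have h3 := (h.measurable_reward w).stronglyMeasurable.mono (ℱ.mono hw')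
  exact h2.mul (((h1.sub h3).const_mul l).sub ((stronglyMeasurable_const.sub h1).const_mul _))

open scoped Classical in
/-- The rounds from `s` on in which the strategy of round `s` is played. -/
noncomputable def replay (x : ℕ → Ω → X) (s w : ℕ) (ω : Ω) : ℝ :=
  if s ≤ w ∧ x w ω = x s ω then 1 else 0

theorem replay_eq_zero_or_one {X : Type u} {Ω : Type v} (x : ℕ → Ω → X) (s w : ℕ) (ω : Ω) :
    replay x s w ω = 0 ∨ replay x s w ω = 1 := by
  unfold replay; split_ifs <;> simp

theorem IsRun.stronglyMeasurable_replay (h : IsRun P A Pr ℱ x y) (s w : ℕ) :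
    StronglyMeasurable[ℱ w] (replay x s w) := by
  classical
  by_cases hs : s ≤ w
  · have hm : MeasurableSet[ℱ w] {ω | x w ω = x s ω} :=
      (h.stronglyMeasurable_play w).measurableSet_eq_fun
        ((h.stronglyMeasurable_play s).mono (ℱ.mono hs))
    have : replay x s w = {ω | x w ω = x s ω}.indicator fun _ => (1 : ℝ) := by
      funext ω; simp [replay, hs, indicator]
    rw [this]
    exact stronglyMeasurable_const.indicator hm
  · have : replay x s w = fun _ => (0 : ℝ) := by
      funext ω; simp [replay, hs]
    rw [this]; exact stronglyMeasurable_const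

/-- The event that in the window `[b, b + n)` some reward leaves `[0, 1]` or the losses of some
strategy deviate too much from their expectation. -/
def deviationEvent (P : Instance X) (x : ℕ → Ω → X) (y : ℕ → Ω → ℝ) (b n : ℕ) (a : ℝ) : Set Ω :=
  (⋃ s ∈ Finset.Ico b (b + n), {ω | y s ω ∈ Icc (0 : ℝ) 1}ᶜ) ∪
  ⋃ p ∈ Finset.Ico b (b + n) ×ˢ Finset.Ioc b (b + n) ×ˢ Finset.Icc 1 n ×ˢ ({1, -1} : Finset ℤ),
    {ω | a ≤ exponent P x y ((p.2.2.2 : ℝ) / (p.2.2.1 : ℝ)) (replay x p.1) p.2.1 ω}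

theorem IsRun.measurableSet_deviationEvent (h : IsRun P A Pr ℱ x y) (b n : ℕ) (a : ℝ) :
    MeasurableSet (deviationEvent P x y b n a) := by
  refine MeasurableSet.union ?_ ?_
  · exact Finset.measurableSet_biUnion _ fun s _ => (h.measurable s measurableSet_Icc).compl
  · refine Finset.measurableSet_biUnion _ fun p _ => ?_
    exact ((h.stronglyMeasurable_exponent _ (h.stronglyMeasurable_replay p.1) _).mono
      (ℱ.le _)).measurable measurableSet_Ici

variable [IsProbabilityMeasure Pr]

theorem IsRun.exponent_le (h : IsRun P A Pr ℱ x y) {l : ℝ} (hl : |l| ≤ 1) {B : ℕ → Ω → ℝ}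
    (hB : ∀ w ω, B w ω = 0 ∨ B w ω = 1) (N : ℕ) :
    ∀ᵐ ω ∂Pr, exponent P x y l B N ω ≤ N := by
  have h0 : ∀ᵐ ω ∂Pr, ∀ w, y w ω ∈ Icc (0 : ℝ) 1 := ae_all_iff.2 h.reward_mem
  filter_upwards [h0] with ω hω
  have : ∀ w ∈ Finset.range N, B w ω *
    (l * (P.payoff (x w ω) - y w ω) - l ^ 2 * (1 - P.payoff (x w ω))) ≤ 1 := by
    intro w _
    have h1 := P.payoff_mem (x w ω)
    have h2 : l * (P.payoff (x w ω) - y w ω) ≤ 1 := by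
      refine (le_abs_self _).trans ?_
      rw [abs_mul]
      refine mul_le_one₀ hl (abs_nonneg _) (abs_le.2 ⟨?_, ?_⟩) <;> linarith [h1.1, h1.2, (hω w).1, (hω w).2]
    have h3 : 0 ≤ l ^ 2 * (1 - P.payoff (x w ω)) :=
      mul_nonneg (sq_nonneg _) (by linarith [h1.2])
    rcases hB w ω with hb | hb <;> rw [hb] <;> linarith
  calc exponent P x y l B N ω ≤ ∑ w ∈ Finset.range N, (1 : ℝ) := Finset.sum_le_sum this
    _ = N := by simp

theorem IsRun.integrable_exp_exponent (h : IsRun P A Pr ℱ x y) {l : ℝ} (hl : |l| ≤ 1)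
    {B : ℕ → Ω → ℝ} (hBm : ∀ w, StronglyMeasurable[ℱ w] (B w))
    (hB : ∀ w ω, B w ω = 0 ∨ B w ω = 1) (N : ℕ) :
    Integrable (fun ω => Real.exp (exponent P x y l B N ω)) Pr := by
  refine Integrable.of_bound (C := Real.exp N) ?_ ?_
  · exact (Real.continuous_exp.comp_stronglyMeasurable
      ((h.stronglyMeasurable_exponent l hBm N).mono (ℱ.le N))).aestronglyMeasurable
  · filter_upwards [h.exponent_le hl hB N] with ω hω
    rw [Real.norm_eq_abs, abs_of_pos (Real.exp_pos _)]
    exact Real.exp_le_exp.2 hω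

/-- The past `M` and the compensator `F` are known before the reward is drawn. The remaining factor
e^(l(1 - y)) is bounded by its chord, which is affine in y, so taking conditional expectations
replaces y by the payoff; `exp_mul_one_add_le` then finishes. -/
theorem IsRun.integral_exp_exponent_succ_le (h : IsRun P A Pr ℱ x y) {l : ℝ} (hl : |l| ≤ 1)
    {B : ℕ → Ω → ℝ} (hBm : ∀ w, StronglyMeasurable[ℱ w] (B w))
    (hB : ∀ w ω, B w ω = 0 ∨ B w ω = 1) (N : ℕ) :
    ∫ ω, Real.exp (exponent P x y l B (N + 1) ω) ∂Pr
      ≤ ∫ ω, Real.exp (exponent P x y l B N ω) ∂Pr := by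
  set M : Ω → ℝ := fun ω => Real.exp (exponent P x y l B N ω)
  set q : Ω → ℝ := fun ω => 1 - P.payoff (x N ω)
  set F : Ω → ℝ := fun ω => Real.exp (-((l + l ^ 2) * (B N ω * q ω)))
  set g : Ω → ℝ := fun ω => M ω * F ω
  set a : ℝ := Real.exp l - 1
  have hq0 : ∀ ω, 0 ≤ q ω := fun ω => sub_nonneg.2 (P.payoff_mem _).2
  have hq1 : ∀ ω, q ω ≤ 1 := fun ω => by have := (P.payoff_mem (x N ω)).1; simp only [q]; linarith
  have hqm : StronglyMeasurable[ℱ N] q := stronglyMeasurable_const.sub (h.measurable_payoff N)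
  have hMm : StronglyMeasurable[ℱ N] M :=
    Real.continuous_exp.comp_stronglyMeasurable (h.stronglyMeasurable_exponent l hBm N)
  have hFm : StronglyMeasurable[ℱ N] F :=
    Real.continuous_exp.comp_stronglyMeasurable ((((hBm N).mul hqm).const_mul _).neg)
  have hgm : StronglyMeasurable[ℱ N] g := hMm.mul hFm
  have hMb := h.exponent_le hl hB N
  have hl' := abs_le.1 hl
  have hB01 : ∀ ω, 0 ≤ B N ω ∧ B N ω ≤ 1 := fun ω => by
    rcases hB N ω with hb | hb <;> rw [hb] <;> norm_num
  have hFb : ∀ ω, F ω ≤ Real.exp 1 := fun ω => Real.exp_le_exp.2 (by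
    have h1 : 0 ≤ B N ω * q ω := mul_nonneg (hB01 ω).1 (hq0 ω)
    have h2 : B N ω * q ω ≤ 1 := mul_le_one₀ (hB01 ω).2 (hq0 ω) (hq1 ω)
    nlinarith [sq_nonneg (l + 1 / 2)])
  have hgb : ∀ᵐ ω ∂Pr, |g ω| ≤ Real.exp N * Real.exp 1 := by
    filter_upwards [hMb] with ω hω
    rw [abs_of_pos (mul_pos (Real.exp_pos _) (Real.exp_pos _))]
    exact mul_le_mul (Real.exp_le_exp.2 hω) (hFb ω) (Real.exp_pos _).le (Real.exp_pos _).le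
  have hgBm : StronglyMeasurable[ℱ N] fun ω => g ω * B N ω := hgm.mul (hBm N)
  have hgBb : ∀ᵐ ω ∂Pr, |g ω * B N ω| ≤ Real.exp N * Real.exp 1 := by
    filter_upwards [hgb] with ω hω
    rw [abs_mul, abs_of_nonneg (hB01 ω).1]
    exact (mul_le_of_le_one_right (abs_nonneg _) (hB01 ω).2).trans hω
  have hgi : Integrable g Pr :=
    Integrable.of_bound (hgm.mono (ℱ.le N)).aestronglyMeasurable _ hgb
  have hgBi : Integrable (fun ω => g ω * B N ω) Pr :=
    Integrable.of_bound (hgBm.mono (ℱ.le N)).aestronglyMeasurable _ hgBb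
  have hgBy : Integrable (fun ω => g ω * B N ω * y N ω) Pr :=
    (h.integrable N).bdd_mul (hgBm.mono (ℱ.le N)).aestronglyMeasurable hgBb
  have hgBp : Integrable (fun ω => g ω * B N ω * P.payoff (x N ω)) Pr := by
    refine Integrable.bdd_mul (c := Real.exp N * Real.exp 1) ?_
      (hgBm.mono (ℱ.le N)).aestronglyMeasurable hgBb
    refine Integrable.of_bound ((h.measurable_payoff N).mono (ℱ.le N)).aestronglyMeasurable 1 ?_
    refine ae_of_all _ fun ω => ?_
    rw [Real.norm_eq_abs, abs_of_nonneg (P.payoff_mem _).1]; exact (P.payoff_mem _).2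
  have step1 : ∫ ω, Real.exp (exponent P x y l B (N + 1) ω) ∂Pr
      ≤ ∫ ω, (g ω + a * (g ω * B N ω) - a * (g ω * B N ω * y N ω)) ∂Pr := by
    refine integral_mono_ae (h.integrable_exp_exponent hl hBm hB (N + 1))
      ((hgi.add (hgBi.const_mul a)).sub (hgBy.const_mul a)) ?_
    filter_upwards [h.reward_mem N] with ω hω
    have e1 : exponent P x y l B (N + 1) ω = exponent P x y l B N ω + B N ω *
        (l * (P.payoff (x N ω) - y N ω) - l ^ 2 * (1 - P.payoff (x N ω))) := by
      unfold exponent; rw [Finset.sum_range_succ]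
    rw [e1, Real.exp_add]
    have e2 : g ω + a * (g ω * B N ω) - a * (g ω * B N ω * y N ω)
        = M ω * (F ω * (1 + a * (B N ω * (1 - y N ω)))) := by simp only [g]; ring
    rw [e2]
    refine mul_le_mul_of_nonneg_left ?_ (Real.exp_pos _).le
    rcases hB N ω with hb | hb
    · simp [F, hb]
    · have e3 : B N ω * (l * (P.payoff (x N ω) - y N ω) - l ^ 2 * (1 - P.payoff (x N ω)))
          = -((l + l ^ 2) * (B N ω * q ω)) + l * (1 - y N ω) := by
        simp only [hb, q]; ring
      rw [e3, Real.exp_add]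
      refine mul_le_mul_of_nonneg_left ?_ (Real.exp_pos _).le
      rw [hb, one_mul]
      exact exp_mul_le_of_mem_Icc l ⟨by linarith [hω.2], by linarith [hω.1]⟩
  refine step1.trans ?_
  have e4 : ∫ ω, (g ω + a * (g ω * B N ω) - a * (g ω * B N ω * y N ω)) ∂Pr
      = ∫ ω, (g ω + a * (g ω * B N ω) - a * (g ω * B N ω * P.payoff (x N ω))) ∂Pr := by
    have hsum : Integrable (fun ω => g ω + a * (g ω * B N ω)) Pr := hgi.add (hgBi.const_mul a)
    rw [integral_sub hsum (hgBy.const_mul a), integral_sub hsum (hgBp.const_mul a),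
      integral_const_mul, integral_const_mul, h.integral_mul_reward N hgBm hgBb]
  rw [e4]
  refine integral_mono ((hgi.add (hgBi.const_mul a)).sub (hgBp.const_mul a))
    (h.integrable_exp_exponent hl hBm hB N) fun ω => ?_
  have e5 : g ω + a * (g ω * B N ω) - a * (g ω * B N ω * P.payoff (x N ω))
        = M ω * (F ω * (1 + a * (B N ω * q ω))) := by simp only [g, q]; ring
  show g ω + a * (g ω * B N ω) - a * (g ω * B N ω * P.payoff (x N ω)) ≤ M ω
  rw [e5]
  refine mul_le_of_le_one_right (Real.exp_pos _).le ?_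
  exact exp_mul_one_add_le hl (mul_nonneg (hB01 ω).1 (hq0 ω))

theorem IsRun.integral_exp_exponent_le_one (h : IsRun P A Pr ℱ x y) {l : ℝ} (hl : |l| ≤ 1)
    {B : ℕ → Ω → ℝ} (hBm : ∀ w, StronglyMeasurable[ℱ w] (B w))
    (hB : ∀ w ω, B w ω = 0 ∨ B w ω = 1) (N : ℕ) :
    ∫ ω, Real.exp (exponent P x y l B N ω) ∂Pr ≤ 1 := by
  induction N with
  | zero => simp [exponent]
  | succ N ih => exact (h.integral_exp_exponent_succ_le hl hBm hB N).trans ih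

theorem IsRun.measureReal_le_exponent (h : IsRun P A Pr ℱ x y) {l : ℝ} (hl : |l| ≤ 1)
    {B : ℕ → Ω → ℝ} (hBm : ∀ w, StronglyMeasurable[ℱ w] (B w))
    (hB : ∀ w ω, B w ω = 0 ∨ B w ω = 1) (N : ℕ) (a : ℝ) :
    Pr.real {ω | a ≤ exponent P x y l B N ω} ≤ Real.exp (-a) := by
  have h1 := mul_meas_ge_le_integral_of_nonneg (μ := Pr)
    (f := fun ω => Real.exp (exponent P x y l B N ω)) (ae_of_all _ fun ω => (Real.exp_pos _).le)
    (h.integrable_exp_exponent hl hBm hB N) (Real.exp a)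
  simp only [Real.exp_le_exp] at h1
  have h2 := h1.trans (h.integral_exp_exponent_le_one hl hBm hB N)
  rw [Real.exp_neg, ← one_div, le_div_iff₀ (Real.exp_pos a), mul_comm]
  exact h2

/-- Starting round, end round, k and sign give 2n³ events, each of probability at most e^(-a) by
Markov's inequality. A whole grid of parameters ±1/k is needed because the best one depends on the
random number of plays. -/
theorem IsRun.measureReal_deviationEvent_le (h : IsRun P A Pr ℱ x y) (b n : ℕ) (a : ℝ) :
    Pr.real (deviationEvent P x y b n a) ≤ 2 * (n : ℝ) ^ 3 * Real.exp (-a) := by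
  unfold deviationEvent
  refine (measureReal_union_le _ _).trans ?_
  have h1 : Pr.real (⋃ s ∈ Finset.Ico b (b + n), {ω | y s ω ∈ Icc (0 : ℝ) 1}ᶜ) = 0 := by
    refine le_antisymm ((measureReal_biUnion_finset_le _ _).trans
      (Finset.sum_nonpos fun s _ => ?_)) measureReal_nonneg
    rw [measureReal_def, show Pr {ω | y s ω ∈ Icc (0 : ℝ) 1}ᶜ = 0 from h.reward_mem s,
      ENNReal.toReal_zero]
  rw [h1, zero_add]
  refine (measureReal_biUnion_finset_le _ _).trans ?_
  refine (Finset.sum_le_card_nsmul _ _ (Real.exp (-a)) ?_).trans ?_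
  · intro p hp
    simp only [Finset.mem_product, Finset.mem_Icc] at hp
    refine h.measureReal_le_exponent ?_ (h.stronglyMeasurable_replay p.1)
      (replay_eq_zero_or_one x p.1) _ _
    have h2 : (1 : ℝ) ≤ (p.2.2.1 : ℝ) := by exact_mod_cast hp.2.2.1.1
    have h3 : |(p.2.2.2 : ℝ)| = 1 := by
      have := hp.2.2.2
      simp only [Finset.mem_insert, Finset.mem_singleton] at this
      rcases this with h | h <;> rw [h] <;> norm_num
    rw [abs_div, h3, Nat.abs_cast]
    exact div_le_one_of_le₀ h2 (by linarith)
  · simp only [Finset.card_product, Nat.card_Ico, Nat.card_Ioc, Nat.card_Icc, nsmul_eq_mul]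
    have : ({1, -1} : Finset ℤ).card = 2 := rfl
    rw [this]
    apply le_of_eq
    have : b + n - b = n := by omega
    rw [this]
    push_cast
    ring

end Run

/-! ### Inequalities for the relative radius -/

section Numeric

theorem abs_le_of_forall_div_add_mul {a q D L : ℝ} {n l : ℕ} (ha : 1 ≤ a) (hn : 1 ≤ n) (hnl : n ≤ l)
    (hq0 : 0 ≤ q) (hq1 : q ≤ 1) (hL : 0 ≤ L) (hLD : n * q = L - D)
    (hD : ∀ k ∈ Finset.Icc 1 l, |D| ≤ n * q / k + a * k) :
    |D| ≤ 2 * Real.sqrt (a * L) + 6 * a := by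
  have hn' : (1 : ℝ) ≤ n := by exact_mod_cast hn
  have hnl' : (n : ℝ) ≤ l := by exact_mod_cast hnl
  set σ := Real.sqrt (n * q / a)
  have hσ0 : 0 ≤ σ := Real.sqrt_nonneg _
  have hσ2 : a * σ ^ 2 = n * q := by
    rw [Real.sq_sqrt (by positivity)]; field_simp
  have hσl : σ ≤ l := by
    rw [Real.sqrt_le_left (by positivity), div_le_iff₀ (by positivity)]
    nlinarith
  -- The right side of `hD` is minimal near k = σ. The range up to l contains this k because a ≥ 1
  -- and n * q ≤ l give σ ≤ l.
  set k := max 1 ⌈σ⌉₊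
  have hk1 : 1 ≤ k := le_max_left _ _
  have hkl : k ≤ l := max_le (hn.trans hnl) (Nat.ceil_le.2 hσl)
  have hkσ : σ ≤ k := (Nat.le_ceil σ).trans (by exact_mod_cast le_max_right _ _)
  have hkσ' : (k : ℝ) ≤ σ + 1 := by
    simp only [k, Nat.cast_max, Nat.cast_one, max_le_iff]
    exact ⟨by linarith, (Nat.ceil_lt_add_one hσ0).le⟩
  have hk0 : (1 : ℝ) ≤ k := by exact_mod_cast hk1
  have h1 := hD k (Finset.mem_Icc.2 ⟨hk1, hkl⟩)
  have h2 : n * q / k ≤ a * σ := by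
    rw [div_le_iff₀ (by linarith), ← hσ2]
    nlinarith [mul_le_mul_of_nonneg_left hkσ (mul_nonneg (by linarith : 0 ≤ a) hσ0)]
  have h3 : |D| ≤ 2 * (a * σ) + a := by nlinarith
  set s := Real.sqrt (a * L)
  have hs0 : 0 ≤ s := Real.sqrt_nonneg _
  have hs2 : s ^ 2 = a * L := Real.sq_sqrt (by positivity)
  -- The unknown n * q is the observed loss L minus the deviation D, and |D| is itself bounded in
  -- terms of a * σ. The result is a quadratic inequality for a * σ.
  have h4 : (a * σ) ^ 2 ≤ s ^ 2 + a * (2 * (a * σ) + a) := by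
    have : (a * σ) ^ 2 = a * (L - D) := by rw [← hLD, ← hσ2]; ring
    rw [this, hs2]
    have := neg_abs_le D
    nlinarith
  have h5 : a * σ ≤ s + 5 / 2 * a := by
    by_contra hc
    push Not at hc
    nlinarith [mul_nonneg hs0 (by linarith : (0:ℝ) ≤ a)]
  linarith

/-- Passing from n to 1 + n in the denominators costs at most a factor 2, which the factor 32
absorbs with room to spare. -/
theorem abs_sub_le_relativeRadius {a μ Y : ℝ} {n l : ℕ} (ha : 1 ≤ a) (hn : 1 ≤ n) (hnl : n ≤ l)
    (hμ : μ ∈ Icc (0 : ℝ) 1) (hY : Y ≤ n)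
    (hD : ∀ k ∈ Finset.Icc 1 l, |n * μ - Y| ≤ n * (1 - μ) / k + a * k) :
    |Y / n - μ| ≤ relativeRadius (32 * a) n (Y / n) := by
  have hn' : (1 : ℝ) ≤ n := by exact_mod_cast hn
  have h1 := abs_le_of_forall_div_add_mul (L := n - Y) ha hn hnl (sub_nonneg.2 hμ.2)
    (by linarith [hμ.1]) (by linarith) (by ring) hD
  have h2 : |Y / n - μ| = |n * μ - Y| / n := by
    rw [← abs_neg, ← abs_of_pos (by linarith : (0 : ℝ) < n), ← abs_div,
      abs_of_pos (by linarith : (0 : ℝ) < n)]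
    congr 1; field_simp; ring
  have h3 : 4 * (Real.sqrt (a * (n - Y)) / n)
      ≤ Real.sqrt (32 * a * ((1 - Y / n) / (1 + n))) := by
    apply Real.le_sqrt_of_sq_le
    rw [mul_pow, div_pow, Real.sq_sqrt (mul_nonneg (by linarith) (by linarith))]
    have e : 32 * a * ((1 - Y / n) / (1 + n)) = 16 * (a * (n - Y) * 2 / (n * (1 + n))) := by
      field_simp; ring
    rw [e]
    have : a * (n - Y) / (n : ℝ) ^ 2 ≤ a * (n - Y) * 2 / (n * (1 + n)) := by
      rw [div_le_div_iff₀ (by positivity) (by positivity)]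
      have : 0 ≤ a * (n - Y) := mul_nonneg (by linarith) (by linarith)
      have h : (n : ℝ) * (1 + n) ≤ 2 * n ^ 2 := by nlinarith
      nlinarith
    linarith
  have h4 : 6 * a / n ≤ 32 * a / (1 + n) := by
    rw [div_le_div_iff₀ (by positivity) (by positivity)]
    nlinarith
  have h5 : 0 ≤ Real.sqrt (a * (n - Y)) / n := by positivity
  unfold relativeRadius
  rw [h2]
  calc |n * μ - Y| / n ≤ (2 * Real.sqrt (a * (n - Y)) + 6 * a) / n := by gcongr
    _ = 2 * (Real.sqrt (a * (n - Y)) / n) + 6 * a / n := by ring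
    _ ≤ _ := by linarith

/-- Replaces the empirical loss by the true one. With s the square root in the radius, 1 - m exceeds
1 - μ by at most A + s, so s² ≤ t² + A (A + s), and this forces s ≤ 2A + 2t. -/
theorem relativeRadius_le {α n m μ : ℝ} (hα : 0 ≤ α) (hn : 0 ≤ n) (hμ : μ ≤ 1) (hm : m ≤ 1)
    (h : |m - μ| ≤ relativeRadius α n m) :
    relativeRadius α n m ≤ 3 * (α / (1 + n)) + 2 * Real.sqrt (α / (1 + n) * (1 - μ)) := by
  set A := α / (1 + n)
  have hA : 0 ≤ A := by positivity
  set s := Real.sqrt (α * ((1 - m) / (1 + n)))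
  have hs0 : 0 ≤ s := Real.sqrt_nonneg _
  have hs : s ^ 2 = A * (1 - m) := by
    rw [Real.sq_sqrt (mul_nonneg hα (div_nonneg (by linarith) (by linarith)))]
    simp only [A]; ring
  have hr : relativeRadius α n m = A + s := rfl
  rw [hr] at h ⊢
  set t := Real.sqrt (A * (1 - μ))
  have ht0 : 0 ≤ t := Real.sqrt_nonneg _
  have ht : t ^ 2 = A * (1 - μ) := Real.sq_sqrt (mul_nonneg hA (by linarith))
  have h1 : s ^ 2 ≤ t ^ 2 + A * (A + s) := by
    rw [hs, ht]
    have := (abs_le.1 h).1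
    nlinarith
  by_contra hc
  push Not at hc
  nlinarith [mul_nonneg hA ht0]

/-- Here Δ ≤ 9A + 6t. After multiplication by Δ, 6tΔ ≤ Δ² / 2 + 18t², and both AΔ and t² are at most
A w; hence 54 = 2 (9 + 18). -/
theorem sq_le_of_le_radius {α n m μ Δ w : ℝ} (hα : 0 ≤ α) (hn : 0 ≤ n) (hμ : μ ≤ 1) (hm : m ≤ 1)
    (h : |m - μ| ≤ relativeRadius α n m) (hΔ0 : 0 ≤ Δ) (hΔ : Δ ≤ 3 * relativeRadius α n m)
    (hΔw : Δ ≤ w) (hw : 1 - μ ≤ w) : (n + 1) * Δ ^ 2 ≤ 54 * α * w := by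
  have h1 := relativeRadius_le hα hn hμ hm h
  set A := α / (1 + n)
  have hA : 0 ≤ A := by positivity
  have hAα : (n + 1) * A = α := by simp only [A]; field_simp; ring
  set t := Real.sqrt (A * (1 - μ))
  have ht0 : 0 ≤ t := Real.sqrt_nonneg _
  have ht : t ^ 2 = A * (1 - μ) := Real.sq_sqrt (mul_nonneg hA (by linarith))
  have h2 : Δ ≤ 9 * A + 6 * t := by linarith
  have h3 : Δ ^ 2 ≤ 54 * (A * w) := by
    have h4 : A * (1 - μ) ≤ A * w := mul_le_mul_of_nonneg_left hw hA
    have h5 : A * Δ ≤ A * w := mul_le_mul_of_nonneg_left hΔw hA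
    nlinarith [sq_nonneg (Δ - 6 * t), mul_le_mul_of_nonneg_left h2 hΔ0]
  calc (n + 1) * Δ ^ 2 ≤ (n + 1) * (54 * (A * w)) := by gcongr
    _ = 54 * ((n + 1) * A) * w := by ring
    _ = 54 * α * w := by rw [hAα]

theorem le_relativeRadius {α n m : ℝ} : α / (1 + n) ≤ relativeRadius α n m := by
  unfold relativeRadius
  linarith [Real.sqrt_nonneg (α * ((1 - m) / (1 + n)))]

/-- While n is small the first term of the new radius alone is at least 1/4. Afterwards one more
play shrinks both terms at most by the factor 3/4, the total loss being nondecreasing by `hm'`, and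
3/4 · Δ/3 = Δ/4. -/
theorem div_four_le_relativeRadius_succ {α n m m' Δ : ℝ} (hα : 10 ≤ α) (hn : 0 ≤ n) (hm : m ≤ 1)
    (hm' : n * (1 - m) ≤ (n + 1) * (1 - m')) (hΔ : Δ ≤ 3 * relativeRadius α n m) (hΔ1 : Δ ≤ 1) :
    Δ / 4 ≤ relativeRadius α (n + 1) m' := by
  by_cases hs : n + 2 ≤ 4 * α
  · refine le_trans ?_ le_relativeRadius
    rw [div_le_div_iff₀ (by norm_num) (by linarith)]
    nlinarith
  push Not at hs
  have h1 : 3 / 4 * (α / (1 + n)) ≤ α / (1 + (n + 1)) := by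
    rw [← mul_div_assoc, div_le_div_iff₀ (by linarith) (by linarith)]
    nlinarith
  have h2 : 3 / 4 * Real.sqrt (α * ((1 - m) / (1 + n)))
      ≤ Real.sqrt (α * ((1 - m') / (1 + (n + 1)))) := by
    apply Real.le_sqrt_of_sq_le
    rw [mul_pow, Real.sq_sqrt (mul_nonneg (by linarith) (div_nonneg (by linarith) (by linarith))),
      mul_left_comm]
    refine mul_le_mul_of_nonneg_left ?_ (by linarith)
    rw [← mul_div_assoc, div_le_div_iff₀ (by linarith) (by linarith)]
    nlinarith
  unfold relativeRadius at hΔ ⊢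
  linarith

end Numeric

/-! ### Location of a round within its phase -/

section Phases

variable {len : ℕ → ℕ}

theorem phaseStart_succ (len : ℕ → ℕ) (i : ℕ) :
    phaseStart len (i + 1) = phaseStart len i + len i := Finset.sum_range_succ _ _

theorem phaseStart_strictMono (hlen : ∀ i, 0 < len i) : StrictMono (phaseStart len) :=
  strictMono_nat_of_lt_succ fun i => by rw [phaseStart_succ]; have := hlen i; omega

theorem phaseOf_eq (hlen : ∀ i, 0 < len i) {i t : ℕ} (h1 : phaseStart len i ≤ t)
    (h2 : t < phaseStart len (i + 1)) : phaseOf len t = i := by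
  unfold phaseOf
  rw [Nat.findGreatest_eq_iff]
  refine ⟨((phaseStart_strictMono hlen).le_apply).trans h1, fun _ => h1, fun n hn _ hc => ?_⟩
  have := (phaseStart_strictMono hlen).monotone (Nat.succ_le_of_lt hn)
  simp only [Nat.succ_eq_add_one] at this
  omega

theorem elapsed_eq (hlen : ∀ i, 0 < len i) {i t : ℕ} (h1 : phaseStart len i ≤ t)
    (h2 : t < phaseStart len (i + 1)) : elapsed len t = t - phaseStart len i := by
  unfold elapsed
  rw [phaseOf_eq hlen h1 h2]

end Phases

/-! ### Empirical counts and averages in terms of rounds -/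

section History

open scoped Classical

variable {X : Type u} {Ω : Type v} (x : ℕ → Ω → X) (y : ℕ → Ω → ℝ)

theorem length_history (t : ℕ) (ω : Ω) : (history x y t ω).length = t := by
  induction t with
  | zero => rfl
  | succ t ih => simp [history, ih]

/-- How often `v` is played in the rounds from `b` to `t - 1`. -/
noncomputable def countIn (b t : ℕ) (ω : Ω) (v : X) : ℕ :=
  ((Finset.Ico b t).filter fun s => x s ω = v).card

/-- The total reward received from `v` in the rounds from `b` to `t - 1`. -/
noncomputable def totalIn (b t : ℕ) (ω : Ω) (v : X) : ℝ :=
  ∑ s ∈ (Finset.Ico b t).filter fun s => x s ω = v, y s ω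

theorem filter_Ico_succ {b t : ℕ} (hbt : b ≤ t) (ω : Ω) (v : X) :
    (Finset.Ico b (t + 1)).filter (fun s => x s ω = v) = if x t ω = v then
      insert t ((Finset.Ico b t).filter fun s => x s ω = v)
      else (Finset.Ico b t).filter fun s => x s ω = v := by
  rw [← Finset.insert_Ico_right_eq_Ico_add_one hbt, Finset.filter_insert]

theorem countIn_succ {b t : ℕ} (hbt : b ≤ t) (ω : Ω) (v : X) :
    countIn x b (t + 1) ω v = countIn x b t ω v + if x t ω = v then 1 else 0 := by
  unfold countIn
  rw [filter_Ico_succ x hbt]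
  split_ifs with h
  · rw [Finset.card_insert_of_notMem (by simp)]
  · rfl

theorem totalIn_succ {b t : ℕ} (hbt : b ≤ t) (ω : Ω) (v : X) :
    totalIn x y b (t + 1) ω v = totalIn x y b t ω v + if x t ω = v then y t ω else 0 := by
  unfold totalIn
  rw [filter_Ico_succ x hbt]
  split_ifs with h
  · rw [Finset.sum_insert (by simp), add_comm]
  · rw [add_zero]

theorem totalIn_le_countIn {b t : ℕ} {ω : Ω} (hy : ∀ s ∈ Finset.Ico b t, y s ω ≤ 1) (v : X) :
    totalIn x y b t ω v ≤ countIn x b t ω v := by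
  unfold totalIn countIn
  refine (Finset.sum_le_card_nsmul _ _ 1 fun s hs => hy s (Finset.mem_filter.1 hs).1).trans ?_
  simp

/-- Histories list the newest observation first, so the first e entries at time b + e are exactly
the rounds from b on. -/
theorem recent_rewards (b e : ℕ) (ω : Ω) (v : X) :
    ((((history x y (b + e) ω).take e).filter fun o => o.1 = v).map Prod.snd).length
        = countIn x b (b + e) ω v ∧
      ((((history x y (b + e) ω).take e).filter fun o => o.1 = v).map Prod.snd).sum
        = totalIn x y b (b + e) ω v := by
  induction e with
  | zero => simp [countIn, totalIn]
  | succ e ih =>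
    have e1 : history x y (b + (e + 1)) ω
        = (x (b + e) ω, y (b + e) ω) :: history x y (b + e) ω := rfl
    rw [e1, List.take_succ_cons, ← add_assoc, countIn_succ x (Nat.le_add_right b e),
      totalIn_succ x y (Nat.le_add_right b e), ← ih.1, ← ih.2]
    by_cases h : x (b + e) ω = v
    · simp [h, add_comm]
    · simp [h]

variable {len : ℕ → ℕ} (hlen : ∀ i, 0 < len i) {i t : ℕ} (h1 : phaseStart len i ≤ t)
  (h2 : t < phaseStart len (i + 1))

include hlen h1 h2

theorem plays_history (ω : Ω) (v : X) :
    plays len (history x y t ω) v = countIn x (phaseStart len i) t ω v := by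
  unfold plays rewardsOf currentPhase
  rw [length_history, elapsed_eq hlen h1 h2]
  obtain ⟨e, rfl⟩ := Nat.exists_eq_add_of_le h1
  rw [Nat.add_sub_cancel_left]
  exact (recent_rewards x y _ e ω v).1

theorem avgReward_history (ω : Ω) (v : X) :
    avgReward len (history x y t ω) v
      = totalIn x y (phaseStart len i) t ω v / countIn x (phaseStart len i) t ω v := by
  unfold avgReward
  rw [plays_history x y hlen h1 h2]
  unfold rewardsOf currentPhase
  rw [length_history, elapsed_eq hlen h1 h2]
  obtain ⟨e, rfl⟩ := Nat.exists_eq_add_of_le h1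
  rw [Nat.add_sub_cancel_left, (recent_rewards x y _ e ω v).2]

theorem radius_history (κ : ℝ) (ω : Ω) (v : X) :
    radius κ len (history x y t ω) v
      = relativeRadius (κ * Real.logb 2 (len i)) (countIn x (phaseStart len i) t ω v)
        (totalIn x y (phaseStart len i) t ω v / countIn x (phaseStart len i) t ω v) := by
  unfold radius phaseParam
  rw [plays_history x y hlen h1 h2, avgReward_history x y hlen h1 h2, length_history,
    phaseOf_eq hlen h1 h2]

end History

/-! ### One activation step and the selection rule -/

section Activation

variable {X : Type u} [MetricSpace X] {κ : ℝ} {len : ℕ → ℕ} {O : CoveringOracle X}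

theorem subset_activate (h : List (X × ℝ)) (S : Finset X) : S ⊆ activate κ len O h S := by
  classical
  unfold activate
  split
  · exact Finset.Subset.refl _
  · exact Finset.subset_insert _ _

theorem radius_le_dist_of_mem_activate {h : List (X × ℝ)} {S : Finset X} {p : X}
    (hp : p ∈ activate κ len O h S) (hpS : p ∉ S) {v : X} (hv : v ∈ S) :
    radius κ len h v ≤ dist p v := by
  classical
  unfold activate at hp
  split at hp
  · exact absurd hp hpS
  · rename_i p' hq
    rcases Finset.mem_insert.1 hp with rfl | hp
    · have := O.uncovered_of_some _ _ hq (v, radius κ len h v) (Finset.mem_image_of_mem _ hv)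
      simpa [Metric.mem_ball] using this
    · exact absurd hp hpS

theorem activate_subsingleton_sdiff {h : List (X × ℝ)} {S : Finset X} {p q : X}
    (hp : p ∈ activate κ len O h S) (hpS : p ∉ S) (hq : q ∈ activate κ len O h S) (hqS : q ∉ S) :
    p = q := by
  classical
  unfold activate at hp hq
  split at hp
  · exact absurd hp hpS
  · rename_i p' hq'
    simp only [hq'] at hq
    rcases Finset.mem_insert.1 hp with rfl | hp
    · rcases Finset.mem_insert.1 hq with rfl | hq
      · rfl
      · exact absurd hq hqS
    · exact absurd hp hpS

/-- One activation per round is enough: an uncovered point is not in S, hence is unplayed, and its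
radius is at least α > 1, so its ball alone covers a space of diameter at most 1. -/
theorem exists_dist_lt_of_activate (hX : ∀ x y : X, dist x y ≤ 1) {h : List (X × ℝ)}
    {S : Finset X} (hα : 1 < phaseParam κ len h.length) (hS : ∀ v, v ∉ S → plays len h v = 0)
    (p : X) : ∃ v ∈ activate κ len O h S, dist p v < radius κ len h v := by
  classical
  cases hq : O.query (S.image fun v => (v, radius κ len h v)) with
  | none =>
    obtain ⟨c, hc, hpc⟩ := O.covers_of_none _ hq p
    obtain ⟨v, hv, rfl⟩ := Finset.mem_image.1 hc
    exact ⟨v, subset_activate _ _ hv, hpc⟩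
  | some q =>
    by_cases hqS : ∀ v ∈ S, dist p v ≥ radius κ len h v
    · refine ⟨q, by simp [activate, hq], ?_⟩
      have hqn : q ∉ S := by
        intro hmem
        have h1 := O.uncovered_of_some _ _ hq (q, radius κ len h q) (Finset.mem_image_of_mem _ hmem)
        have h2 : radius κ len h q ≤ 0 := by simpa [Metric.mem_ball] using h1
        have h3 : 0 < radius κ len h q := by
          refine lt_of_lt_of_le ?_ (le_relativeRadius)
          positivity
        linarith
      have h4 : phaseParam κ len h.length / (1 + (plays len h q : ℝ)) ≤ radius κ len h q :=
        le_relativeRadius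
      rw [hS q hqn, Nat.cast_zero, add_zero, div_one] at h4
      linarith [hX p q]
    · push Not at hqS
      obtain ⟨v, hv, hlt⟩ := hqS
      exact ⟨v, subset_activate _ _ hv, hlt⟩

theorem zoomingRule_mem {τ : TieBreak X} {h : List (X × ℝ)} (hne : (active κ len O h).Nonempty) :
    zoomingRule κ len O τ h ∈ active κ len O h ∧
      ∀ w ∈ active κ len O h, index κ len h w ≤ index κ len h (zoomingRule κ len O τ h) := by
  classical
  obtain ⟨v, hv, hmax⟩ := Finset.exists_max_image _ (index κ len h) hne
  have := τ.choose_mem h ((active κ len O h).filter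
    fun v => ∀ w ∈ active κ len O h, index κ len h w ≤ index κ len h v)
    ⟨v, Finset.mem_filter.2 ⟨hv, hmax⟩⟩
  exact Finset.mem_filter.1 this

end Activation

/-! ### Separation and number of plays in a clean phase -/

section Trajectory

variable {X : Type u} [MetricSpace X] {κ : ℝ} {len : ℕ → ℕ} {O : CoveringOracle X}
  {τ : TieBreak X} {P : Instance X} {Ω : Type v} {x : ℕ → Ω → X} {y : ℕ → Ω → ℝ} {ω : Ω}
  {i t : ℕ}

theorem active_history_start (hlen : ∀ i, 0 < len i) :
    active κ len O (history x y (phaseStart len i) ω)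
      = activate κ len O (history x y (phaseStart len i) ω) ∅ := by
  have hlt : phaseStart len i < phaseStart len (i + 1) := phaseStart_strictMono hlen i.lt_succ_self
  have he : elapsed len (phaseStart len i) = 0 := by
    rw [elapsed_eq hlen le_rfl hlt, Nat.sub_self]
  cases hb : phaseStart len i with
  | zero => rfl
  | succ n =>
    have hl := length_history x y (n + 1) ω
    simp only [history] at hl ⊢
    rw [active, hl, ← hb, he, if_pos rfl]

theorem active_history_succ (hlen : ∀ i, 0 < len i) (h1 : phaseStart len i ≤ t)
    (h2 : t + 1 < phaseStart len (i + 1)) :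
    active κ len O (history x y (t + 1) ω)
      = activate κ len O (history x y (t + 1) ω) (active κ len O (history x y t ω)) := by
  have he : elapsed len (t + 1) ≠ 0 := by
    rw [elapsed_eq hlen (by omega) h2]; omega
  have hl := length_history x y (t + 1) ω
  simp only [history] at hl ⊢
  rw [active, hl, if_neg he]

/-- In phase `i` the rule `zoomingRule κ len O τ` is played, the rewards lie in `[0, 1]`, and every
average reward stays within the confidence radius of the payoff. -/
structure IsClean (κ : ℝ) (len : ℕ → ℕ) (O : CoveringOracle X) (τ : TieBreak X) (P : Instance X)
    (x : ℕ → Ω → X) (y : ℕ → Ω → ℝ) (i : ℕ) (ω : Ω) : Prop where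
  play : ∀ t, x t ω = zoomingRule κ len O τ (history x y t ω)
  reward_mem : ∀ t, phaseStart len i ≤ t → t < phaseStart len (i + 1) → y t ω ∈ Icc (0 : ℝ) 1
  abs_sub_le : ∀ t, phaseStart len i ≤ t → t < phaseStart len (i + 1) → ∀ v,
    |avgReward len (history x y t ω) v - P.payoff v| ≤ radius κ len (history x y t ω) v

theorem exists_dist_lt_of_active_eq (hX : ∀ x y : X, dist x y ≤ 1) (hlen : ∀ i, 0 < len i)
    (hα : 10 ≤ κ * Real.logb 2 (len i)) (h1 : phaseStart len i ≤ t)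
    (h2 : t < phaseStart len (i + 1)) {S : Finset X}
    (hS : active κ len O (history x y t ω) = activate κ len O (history x y t ω) S)
    (hS' : ∀ s, phaseStart len i ≤ s → s < t → x s ω ∈ S) (p : X) :
    ∃ v ∈ active κ len O (history x y t ω), dist p v < radius κ len (history x y t ω) v := by
  classical
  rw [hS]
  refine exists_dist_lt_of_activate hX ?_ ?_ p
  · unfold phaseParam
    rw [length_history, phaseOf_eq hlen h1 h2]; linarith
  · intro v hv
    rw [plays_history x y hlen h1 h2, countIn, Finset.card_eq_zero, Finset.filter_eq_empty_iff]
    rintro s hs rfl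
    rw [Finset.mem_Ico] at hs
    exact hv (hS' s hs.1 hs.2)

/-- At every time of a phase the confidence balls of the active strategies cover the space and the
strategies played so far are active. -/
theorem IsClean.cover (hX : ∀ x y : X, dist x y ≤ 1) (hlen : ∀ i, 0 < len i)
    (hα : 10 ≤ κ * Real.logb 2 (len i))
    (h : IsClean κ len O τ P x y i ω) (h1 : phaseStart len i ≤ t)
    (h2 : t < phaseStart len (i + 1)) :
    (∀ p, ∃ v ∈ active κ len O (history x y t ω),
        dist p v < radius κ len (history x y t ω) v) ∧
      ∀ s, phaseStart len i ≤ s → s ≤ t → x s ω ∈ active κ len O (history x y t ω) := by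
  have key : ∀ t, (∀ p, ∃ v ∈ active κ len O (history x y t ω),
      dist p v < radius κ len (history x y t ω) v) → x t ω ∈ active κ len O (history x y t ω) := by
    intro t ht
    rw [h.play t]
    obtain ⟨v, hv, -⟩ := ht (x t ω)
    exact (zoomingRule_mem ⟨v, hv⟩).1
  induction t, h1 using Nat.le_induction with
  | base =>
    have hc := exists_dist_lt_of_active_eq (O := O) (x := x) (y := y) (ω := ω)
      hX hlen hα le_rfl h2 (active_history_start hlen)
      (fun s h3 h4 => absurd h4 (not_lt.2 h3))
    refine ⟨hc, fun s h3 h4 => ?_⟩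
    rw [le_antisymm h4 h3]
    exact key _ hc
  | succ t h1 ih =>
    obtain ⟨-, ih2⟩ := ih (by omega)
    have hs := active_history_succ (κ := κ) (O := O) (x := x) (y := y) (ω := ω) hlen h1 h2
    have hc := exists_dist_lt_of_active_eq (O := O) (x := x) (y := y) (ω := ω)
      hX hlen hα (by omega) h2 hs (fun s h3 h4 => ih2 s h3 (by omega))
    refine ⟨hc, fun s h3 h4 => ?_⟩
    rcases Nat.lt_or_ge s (t + 1) with h5 | h5
    · rw [hs]
      exact subset_activate _ _ (ih2 s h3 (by omega))
    · rw [le_antisymm h4 h5]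
      exact key _ hc

/-- Any point p lies in the ball of some active w, so its payoff is at most μ(w) + r(w), hence at
most the index of w and at most the maximal index. The latter exceeds the payoff of the played
strategy by at most 3r. Arguing for every p avoids the need for an optimal strategy. -/
theorem IsClean.gap_le (hX : ∀ x y : X, dist x y ≤ 1) (hlen : ∀ i, 0 < len i)
    (hα : 10 ≤ κ * Real.logb 2 (len i))
    (h : IsClean κ len O τ P x y i ω) (h1 : phaseStart len i ≤ t)
    (h2 : t < phaseStart len (i + 1)) :
    P.maxReward - P.payoff (x t ω) ≤ 3 * radius κ len (history x y t ω) (x t ω) := by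
  obtain ⟨hc, -⟩ := h.cover hX hlen hα h1 h2
  have hind : P.maxReward ≤ index κ len (history x y t ω) (x t ω) := by
    have : Nonempty X := ⟨x t ω⟩
    refine ciSup_le fun p => ?_
    obtain ⟨w, hw, hpw⟩ := hc p
    have h3 := (zoomingRule_mem (τ := τ) ⟨w, hw⟩).2 w hw
    rw [← h.play t] at h3
    refine le_trans ?_ h3
    have h4 := (abs_le.1 (P.lipschitz p w)).2
    have h5 := (abs_le.1 (h.abs_sub_le t h1 h2 w)).1
    unfold index
    linarith
  have h6 := (abs_le.1 (h.abs_sub_le t h1 h2 (x t ω))).2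
  unfold index at hind
  linarith

theorem IsClean.avg_le_one (h : IsClean κ len O τ P x y i ω)
    (h2 : t ≤ phaseStart len (i + 1)) (v : X) :
    totalIn x y (phaseStart len i) t ω v ≤ countIn x (phaseStart len i) t ω v := by
  refine totalIn_le_countIn x y (fun s hs => ?_) v
  rw [Finset.mem_Ico] at hs
  exact (h.reward_mem s hs.1 (by omega)).2

/-- A strategy of gap `Δ` keeps a confidence radius of at least `Δ / 4`. -/
theorem IsClean.gap_div_four_le (hX : ∀ x y : X, dist x y ≤ 1) (hlen : ∀ i, 0 < len i)
    (hα : 10 ≤ κ * Real.logb 2 (len i))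
    (h : IsClean κ len O τ P x y i ω) (h1 : phaseStart len i ≤ t)
    (h2 : t < phaseStart len (i + 1)) (v : X) :
    (P.maxReward - P.payoff v) / 4 ≤ radius κ len (history x y t ω) v := by
  have : Nonempty X := ⟨v⟩
  have hgap : P.maxReward - P.payoff v ≤ 1 := by
    linarith [P.maxReward_le, (P.payoff_mem v).1]
  induction t, h1 using Nat.le_induction with
  | base =>
    rw [radius_history x y hlen le_rfl h2]
    refine le_trans ?_ le_relativeRadius
    simp only [countIn, Finset.Ico_self, Finset.filter_empty, Finset.card_empty, Nat.cast_zero,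
      add_zero, div_one]
    linarith
  | succ t h1 ih =>
    have ih := ih (by omega)
    rw [radius_history x y hlen (by omega) h2, countIn_succ x h1, totalIn_succ x y h1]
    rw [radius_history x y hlen h1 (by omega)] at ih
    -- The radius of v changes only when v is played, and at that moment `gap_le` bounds the gap by
    -- three times the old radius.
    by_cases hv : x t ω = v
    · have h3 := h.gap_le hX hlen hα h1 (by omega)
      rw [hv, radius_history x y hlen h1 (by omega)] at h3
      rw [if_pos hv, if_pos hv]
      have h4 := h.avg_le_one (t := t) (by omega) v
      have h5 := (h.reward_mem t h1 (by omega)).2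
      push_cast
      refine div_four_le_relativeRadius_succ hα (Nat.cast_nonneg _) ?_ ?_ h3 hgap
      · exact div_le_one_of_le₀ h4 (Nat.cast_nonneg _)
      · set n : ℝ := (countIn x (phaseStart len i) t ω v : ℝ) with hn
        have hn0 : 0 ≤ n := Nat.cast_nonneg _
        set T := totalIn x y (phaseStart len i) t ω v with hT
        have e1 : n * (1 - T / n) = n - T := by
          -- For an unplayed strategy the default average 0 is harmless, since T = 0 as well.
          by_cases hz : n = 0
          · have : T = 0 := by
              have hz' : countIn x (phaseStart len i) t ω v = 0 :=
                Nat.cast_eq_zero.1 (hn.symm.trans hz)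
              rw [countIn, Finset.card_eq_zero] at hz'
              rw [hT, totalIn, hz', Finset.sum_empty]
            rw [hz, this]; ring
          · field_simp
        have e2 : (n + 1) * (1 - (T + y t ω) / (n + 1)) = n + 1 - (T + y t ω) := by
          field_simp
        rw [e1, e2]; linarith
    · rw [if_neg hv, if_neg hv, add_zero, add_zero]
      exact ih

/-- When the later of the two was activated, it lay outside the ball of the earlier one, whose
radius is at least a quarter of a gap exceeding ρ / 2. At most one strategy is activated per round,
so there is always a later one. -/
theorem IsClean.lt_dist (hX : ∀ x y : X, dist x y ≤ 1) (hlen : ∀ i, 0 < len i)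
    (hα : 10 ≤ κ * Real.logb 2 (len i))
    (h : IsClean κ len O τ P x y i ω) (h1 : phaseStart len i ≤ t)
    (h2 : t < phaseStart len (i + 1)) {ρ : ℝ} {u w : X}
    (hu : u ∈ active κ len O (history x y t ω)) (hw : w ∈ active κ len O (history x y t ω))
    (huw : u ≠ w) (huρ : u ∈ P.layer ρ) (hwρ : w ∈ P.layer ρ) : ρ / 8 < dist u w := by
  have step : ∀ t, phaseStart len i ≤ t → t < phaseStart len (i + 1) → ∀ (S : Finset X),
      active κ len O (history x y t ω) = activate κ len O (history x y t ω) S →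
      (∀ u ∈ S, ∀ w ∈ S, u ≠ w → u ∈ P.layer ρ → w ∈ P.layer ρ → ρ / 8 < dist u w) →
      ∀ u ∈ active κ len O (history x y t ω), ∀ w ∈ active κ len O (history x y t ω), u ≠ w →
        u ∈ P.layer ρ → w ∈ P.layer ρ → ρ / 8 < dist u w := by
    intro t h1 h2 S hS hsep u hu w hw huw huρ hwρ
    rw [hS] at hu hw
    have hr : ∀ v ∈ P.layer ρ, ρ / 8 < radius κ len (history x y t ω) v := by
      intro v hv
      have := h.gap_div_four_le hX hlen hα h1 h2 v
      linarith [hv.1]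
    by_cases huS : u ∈ S
    · by_cases hwS : w ∈ S
      · exact hsep u huS w hwS huw huρ hwρ
      · rw [dist_comm]
        exact (hr u huρ).trans_le (radius_le_dist_of_mem_activate hw hwS huS)
    · by_cases hwS : w ∈ S
      · exact (hr w hwρ).trans_le (radius_le_dist_of_mem_activate hu huS hwS)
      · exact absurd (activate_subsingleton_sdiff hu huS hw hwS) huw
  have all : ∀ u ∈ active κ len O (history x y t ω), ∀ w ∈ active κ len O (history x y t ω),
      u ≠ w → u ∈ P.layer ρ → w ∈ P.layer ρ → ρ / 8 < dist u w := by
    clear hu hw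
    induction t, h1 using Nat.le_induction with
    | base => exact step _ le_rfl h2 ∅ (active_history_start hlen) (by simp)
    | succ t h1 ih =>
      exact step _ (by omega) h2 _ (active_history_succ hlen h1 h2) (ih (by omega))
  exact all u hu w hw huw huρ hwρ

/-- A play following n earlier ones happens only if the gap is at most 3r, and `sq_le_of_le_radius`
then bounds n + 1, the count after this play. -/
theorem IsClean.countIn_le (hX : ∀ x y : X, dist x y ≤ 1) (hlen : ∀ i, 0 < len i)
    (hα : 10 ≤ κ * Real.logb 2 (len i))
    (h : IsClean κ len O τ P x y i ω) (h1 : phaseStart len i ≤ t)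
    (h2 : t ≤ phaseStart len (i + 1)) {v : X} {K : ℝ} (hK0 : 0 ≤ K)
    (hv : P.payoff v < P.maxReward)
    (hK : 54 * (κ * Real.logb 2 (len i)) * max (P.maxReward - P.payoff v) (1 - P.payoff v)
      ≤ K * (P.maxReward - P.payoff v) ^ 2) :
    (countIn x (phaseStart len i) t ω v : ℝ) ≤ K := by
  induction t, h1 using Nat.le_induction with
  | base => simpa [countIn] using hK0
  | succ t h1 ih =>
    have ih := ih (by omega)
    rw [countIn_succ x h1]
    split_ifs with hxv
    · have h3 := h.gap_le hX hlen hα h1 (by omega)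
      have h4 := h.abs_sub_le t h1 (by omega) v
      rw [hxv, radius_history x y hlen h1 (by omega)] at h3
      rw [radius_history x y hlen h1 (by omega), avgReward_history x y hlen h1 (by omega)] at h4
      have h5 := sq_le_of_le_radius (by linarith) (Nat.cast_nonneg _) (P.payoff_mem v).2
        (div_le_one_of_le₀ (h.avg_le_one (by omega) v) (Nat.cast_nonneg _)) h4
        (by linarith) h3 (le_max_left _ _) (le_max_right (P.maxReward - P.payoff v) _)
      push_cast
      exact le_of_mul_le_mul_right (h5.trans hK) (pow_pos (sub_pos.2 hv) 2)
    · simpa using ih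

open scoped Classical in
/-- In a clean phase, the layer at `ρ` is played at most `n * K` times, if it is covered by `n` sets
of diameter at most `ρ / 8` and the bound `K` holds for every single strategy. -/
theorem IsClean.card_layer_le (hX : ∀ x y : X, dist x y ≤ 1) (hlen : ∀ i, 0 < len i)
    (hα : 10 ≤ κ * Real.logb 2 (len i))
    (h : IsClean κ len O τ P x y i ω) {ρ : ℝ} (hρ : 0 < ρ) {n : ℕ} {S : Fin n → Set X}
    (hS : ∀ j, Metric.ediam (S j) ≤ ENNReal.ofReal (ρ / 8)) (hcov : P.layer ρ ⊆ ⋃ j, S j)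
    {K : ℝ} (hK0 : 0 ≤ K)
    (hK : ∀ v ∈ P.layer ρ, 54 * (κ * Real.logb 2 (len i)) *
      max (P.maxReward - P.payoff v) (1 - P.payoff v) ≤ K * (P.maxReward - P.payoff v) ^ 2) :
    (((Finset.Ico (phaseStart len i) (phaseStart len (i + 1))).filter
      fun s => x s ω ∈ P.layer ρ).card : ℝ) ≤ n * K := by
  have hlt : phaseStart len i < phaseStart len (i + 1) := phaseStart_strictMono hlen i.lt_succ_self
  -- T is the last round of the phase. Its active set contains every strategy played during the
  -- phase, and the separation of its members makes the choice of a covering set injective.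
  obtain ⟨T, hT⟩ : ∃ T, phaseStart len (i + 1) = T + 1 := ⟨phaseStart len (i + 1) - 1, by omega⟩
  set V := (active κ len O (history x y T ω)).filter fun v => v ∈ P.layer ρ with hV
  have hVn : V.card ≤ n := by
    have hex : ∀ v ∈ V, ∃ j, v ∈ S j := fun v hv =>
      mem_iUnion.1 (hcov (Finset.mem_filter.1 hv).2)
    choose f hf using hex
    have hinj : Function.Injective fun v : V => f v.1 v.2 := by
      intro v w hvw
      by_contra hne
      have hne' : v.1 ≠ w.1 := fun h => hne (Subtype.ext h)
      obtain ⟨hv1, hv2⟩ := Finset.mem_filter.1 v.2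
      obtain ⟨hw1, hw2⟩ := Finset.mem_filter.1 w.2
      have h3 := h.lt_dist hX hlen hα (by omega) (by omega) hv1 hw1 hne' hv2 hw2
      have hvw' : f v.1 v.2 = f w.1 w.2 := hvw
      have h4 := (Metric.edist_le_ediam_of_mem (hf v.1 v.2) (hvw' ▸ hf w.1 w.2)).trans (hS _)
      rw [edist_dist, ENNReal.ofReal_le_ofReal_iff (by positivity)] at h4
      linarith
    simpa using Fintype.card_le_of_injective _ hinj
  have hmaps : ∀ s ∈ (Finset.Ico (phaseStart len i) (phaseStart len (i + 1))).filter
      (fun s => x s ω ∈ P.layer ρ), x s ω ∈ V := by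
    intro s hs
    obtain ⟨hs1, hs2⟩ := Finset.mem_filter.1 hs
    rw [Finset.mem_Ico] at hs1
    exact Finset.mem_filter.2
      ⟨(h.cover hX hlen hα (by omega) (by omega)).2 s hs1.1 (by omega), hs2⟩
  rw [Finset.card_eq_sum_card_fiberwise hmaps, Nat.cast_sum]
  calc _ ≤ ∑ v ∈ V, K := by
        refine Finset.sum_le_sum fun v hv => ?_
        have hvρ := (Finset.mem_filter.1 hv).2
        refine le_trans ?_ (h.countIn_le hX hlen hα hlt.le le_rfl hK0 (v := v)
          (by linarith [hvρ.1]) (hK v hvρ))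
        unfold countIn
        rw [Finset.filter_filter]
        exact_mod_cast Finset.card_le_card fun s hs => by
          simp only [Finset.mem_filter] at hs ⊢
          exact ⟨hs.1, hs.2.2⟩
    _ = V.card * K := by simp
    _ ≤ n * K := by gcongr

end Trajectory

/-! ### From clean phases to expected numbers of plays -/

section Run

variable {X : Type u} [MetricSpace X] {κ : ℝ} {len : ℕ → ℕ} {O : CoveringOracle X}
  {τ : TieBreak X} {P : Instance X} {Ω : Type v} {x : ℕ → Ω → X} {y : ℕ → Ω → ℝ}

/-- If s is the first round from b on with its strategy, replaying from s on misses no play, and the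
supermartingale exponent is expressed by the empirical count and total. -/
theorem exponent_replay_eq (P : Instance X) (l : ℝ) {b s t : ℕ} {ω : Ω}
    (hs : ∀ w, b ≤ w → w < t → x w ω = x s ω → s ≤ w) (hbs : b ≤ s) :
    exponent P x y l (replay x s) t ω
      = l * (countIn x b t ω (x s ω) * P.payoff (x s ω) - totalIn x y b t ω (x s ω))
        - l ^ 2 * (countIn x b t ω (x s ω) * (1 - P.payoff (x s ω))) := by
  classical
  have h1 : exponent P x y l (replay x s) t ω
      = ∑ w ∈ (Finset.Ico b t).filter fun w => x w ω = x s ω,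
        (l * (P.payoff (x s ω) - y w ω) - l ^ 2 * (1 - P.payoff (x s ω))) := by
    have e : (Finset.Ico b t).filter (fun w => x w ω = x s ω)
        = (Finset.range t).filter fun w => s ≤ w ∧ x w ω = x s ω := by
      ext w
      simp only [Finset.mem_filter, Finset.mem_Ico, Finset.mem_range]
      constructor
      · rintro ⟨⟨h1, h2⟩, h3⟩
        exact ⟨h2, hs w h1 h2 h3, h3⟩
      · rintro ⟨h1, h2, h3⟩
        exact ⟨⟨by omega, h1⟩, h3⟩
    rw [e, Finset.sum_filter]
    refine Finset.sum_congr rfl fun w _ => ?_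
    unfold replay
    by_cases hc : s ≤ w ∧ x w ω = x s ω
    · rw [if_pos hc, if_pos hc, hc.2, one_mul]
    · rw [if_neg hc, if_neg hc, zero_mul]
  rw [h1, Finset.sum_sub_distrib, ← Finset.mul_sum, Finset.sum_sub_distrib]
  simp only [Finset.sum_const, nsmul_eq_mul, totalIn, countIn]
  ring

theorem isClean_of_notMem_deviationEvent (hlen : ∀ i, 0 < len i) {i : ℕ} {a : ℝ} (ha : 1 ≤ a)
    (haκ : κ * Real.logb 2 (len i) = 32 * a) {ω : Ω}
    (hplay : ∀ t, x t ω = zoomingRule κ len O τ (history x y t ω))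
    (hω : ω ∉ deviationEvent P x y (phaseStart len i) (len i) a) :
    IsClean κ len O τ P x y i ω := by
  classical
  rw [deviationEvent, mem_union, not_or] at hω
  obtain ⟨hω1, hω2⟩ := hω
  have hy : ∀ t, phaseStart len i ≤ t → t < phaseStart len (i + 1) → y t ω ∈ Icc (0 : ℝ) 1 := by
    intro t h1 h2
    by_contra hc
    rw [phaseStart_succ] at h2
    exact hω1 (mem_biUnion (Finset.mem_coe.2 (Finset.mem_Ico.2 ⟨h1, h2⟩)) hc)
  refine ⟨hplay, hy, fun t h1 h2 v => ?_⟩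
  rw [avgReward_history x y hlen h1 h2, radius_history x y hlen h1 h2, haκ]
  rcases Nat.eq_zero_or_pos (countIn x (phaseStart len i) t ω v) with h0 | h0
  -- An unplayed strategy has average 0 and radius at least 32a ≥ 1, which dominates any payoff.
  · rw [h0]
    refine le_trans ?_ le_relativeRadius
    simp only [Nat.cast_zero, div_zero, zero_sub, abs_neg, add_zero, div_one]
    rw [abs_of_nonneg (P.payoff_mem v).1]
    linarith [(P.payoff_mem v).2]
  · have hne : ((Finset.Ico (phaseStart len i) t).filter fun s => x s ω = v).Nonempty :=
      Finset.card_pos.1 h0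
    -- The first play of v replaces v by a round of the phase, one of the finitely many indices of
    -- the deviation event.
    obtain ⟨s, hs, hmin⟩ := Finset.exists_min_image _ id hne
    obtain ⟨hs1, rfl⟩ := Finset.mem_filter.1 hs
    rw [Finset.mem_Ico] at hs1
    have hl := phaseStart_succ len i
    have hcount : countIn x (phaseStart len i) t ω (x s ω) ≤ len i := by
      refine (Finset.card_filter_le _ _).trans ?_
      rw [Nat.card_Ico]; omega
    refine abs_sub_le_relativeRadius (l := len i) ha h0 hcount (P.payoff_mem _) ?_ ?_
    · refine totalIn_le_countIn x y (fun w hw => ?_) _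
      rw [Finset.mem_Ico] at hw
      exact (hy w hw.1 (by omega)).2
    · intro k hk
      have hk1 : (1 : ℝ) ≤ k := by exact_mod_cast (Finset.mem_Icc.1 hk).1
      have hσ : ∀ σ ∈ ({1, -1} : Finset ℤ),
          exponent P x y ((σ : ℝ) / (k : ℝ)) (replay x s) t ω < a := by
        intro σ hσ
        by_contra hc
        refine hω2 (mem_biUnion (x := (s, t, k, σ)) ?_ (not_lt.1 hc))
        simp only [Finset.coe_product, mem_prod, Finset.mem_coe, Finset.mem_Ico, Finset.mem_Ioc]
        exact ⟨by omega, by omega, hk, hσ⟩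
      have hex : ∀ l, exponent P x y l (replay x s) t ω = _ := fun l =>
        exponent_replay_eq (y := y) P l (b := phaseStart len i) (s := s) (t := t) (ω := ω)
          (fun w hw1 hw2 hw3 => hmin w
            (Finset.mem_filter.2 ⟨Finset.mem_Ico.2 ⟨hw1, hw2⟩, hw3⟩)) hs1.1
      set D := countIn x (phaseStart len i) t ω (x s ω) * P.payoff (x s ω)
        - totalIn x y (phaseStart len i) t ω (x s ω)
      set Q := countIn x (phaseStart len i) t ω (x s ω) * (1 - P.payoff (x s ω))
      have h3 := hσ 1 (by simp)
      have h4 := hσ (-1) (by simp)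
      rw [hex] at h3 h4
      push_cast at h3 h4
      have hk0 : (0 : ℝ) < k := by linarith
      have e1 : (1 / (k : ℝ) * D - (1 / (k : ℝ)) ^ 2 * Q) * k = D - Q / k := by field_simp
      have e2 : (-1 / (k : ℝ) * D - (-1 / (k : ℝ)) ^ 2 * Q) * k = -D - Q / k := by field_simp
      have h5 := mul_lt_mul_of_pos_right h3 hk0
      have h6 := mul_lt_mul_of_pos_right h4 hk0
      rw [e1] at h5
      rw [e2] at h6
      rw [abs_le]
      constructor <;> linarith

variable [mΩ : MeasurableSpace Ω] {Pr : Measure Ω} {ℱ : Filtration ℕ mΩ}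

theorem IsRun.measurableSet_layer {A : DecisionRule X} (h : IsRun P A Pr ℱ x y) (ρ : ℝ) (s : ℕ) :
    MeasurableSet {ω | x s ω ∈ P.layer ρ} := by
  have hm : Measurable fun ω => P.maxReward - P.payoff (x s ω) :=
    (((h.measurable_payoff s).mono (ℱ.le s)).measurable).const_sub _
  exact (measurableSet_lt measurable_const hm).inter (measurableSet_le hm measurable_const)

variable [IsProbabilityMeasure Pr]

/-- Off the deviation event `IsClean.card_layer_le` applies. On it the count is at most the phase
length, and `hal` makes length times probability at most 1. -/
theorem IsRun.sum_measureReal_layer_le (hX : ∀ x y : X, dist x y ≤ 1) (hlen : ∀ i, 0 < len i)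
    (h : IsRun P (zoomingRule κ len O τ) Pr ℱ x y) {i : ℕ} {a : ℝ} (ha : 1 ≤ a)
    (haκ : κ * Real.logb 2 (len i) = 32 * a) (hal : 2 * (len i : ℝ) ^ 4 * Real.exp (-a) ≤ 1)
    {ρ : ℝ} (hρ : 0 < ρ) {n : ℕ} {S : Fin n → Set X}
    (hS : ∀ j, Metric.ediam (S j) ≤ ENNReal.ofReal (ρ / 8)) (hcov : P.layer ρ ⊆ ⋃ j, S j)
    {K : ℝ} (hK0 : 0 ≤ K)
    (hK : ∀ v ∈ P.layer ρ, 54 * (κ * Real.logb 2 (len i)) *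
      max (P.maxReward - P.payoff v) (1 - P.payoff v) ≤ K * (P.maxReward - P.payoff v) ^ 2) :
    ∑ s ∈ Finset.Ico (phaseStart len i) (phaseStart len (i + 1)),
      Pr.real {ω | x s ω ∈ P.layer ρ} ≤ n * K + 1 := by
  classical
  set E := deviationEvent P x y (phaseStart len i) (len i) a with hE
  have hEm : MeasurableSet E := h.measurableSet_deviationEvent _ _ _
  set I := Finset.Ico (phaseStart len i) (phaseStart len (i + 1)) with hI
  have hIcard : (I.card : ℝ) = len i := by
    rw [hI, Nat.card_Ico, phaseStart_succ, Nat.add_sub_cancel_left]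
  have hint : ∀ s ∈ I, Integrable ({ω | x s ω ∈ P.layer ρ}.indicator fun _ => (1 : ℝ)) Pr :=
    fun s _ => (integrable_const _).indicator (h.measurableSet_layer ρ s)
  have hpt : ∀ ω, ∑ s ∈ I, {ω | x s ω ∈ P.layer ρ}.indicator (fun _ => (1 : ℝ)) ω
      ≤ n * K + E.indicator (fun _ => (len i : ℝ)) ω := by
    intro ω
    have e : ∑ s ∈ I, {ω | x s ω ∈ P.layer ρ}.indicator (fun _ => (1 : ℝ)) ω
        = ((I.filter fun s => x s ω ∈ P.layer ρ).card : ℝ) := by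
      rw [← Finset.sum_boole]
      rfl
    rw [e]
    by_cases hω : ω ∈ E
    · rw [indicator_of_mem hω, ← hIcard]
      have h1 : ((I.filter fun s => x s ω ∈ P.layer ρ).card : ℝ) ≤ I.card := by
        exact_mod_cast Finset.card_filter_le _ _
      have : 0 ≤ (n : ℝ) * K := by positivity
      linarith
    · rw [indicator_of_notMem hω, add_zero]
      have hc : IsClean κ len O τ P x y i ω :=
        isClean_of_notMem_deviationEvent hlen ha haκ (fun t => h.play t ω) hω
      convert hc.card_layer_le hX hlen (by linarith) hρ hS hcov hK0 hK
  have h1 : ∑ s ∈ I, Pr.real {ω | x s ω ∈ P.layer ρ}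
      = ∫ ω, ∑ s ∈ I, {ω | x s ω ∈ P.layer ρ}.indicator (fun _ => (1 : ℝ)) ω ∂Pr := by
    rw [integral_finsetSum _ hint]
    refine Finset.sum_congr rfl fun s _ => ?_
    rw [integral_indicator_const _ (h.measurableSet_layer ρ s), smul_eq_mul, mul_one]
  rw [h1]
  have hEi : Integrable (E.indicator fun _ => (len i : ℝ)) Pr := (integrable_const _).indicator hEm
  refine (integral_mono (integrable_finsetSum _ hint) ((integrable_const _).add hEi) hpt).trans ?_
  simp only [Pi.add_apply]
  rw [integral_add (integrable_const _) hEi, integral_indicator_const _ hEm]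
  simp only [integral_const, probReal_univ, smul_eq_mul, one_mul]
  refine add_le_add_right ?_ _
  have h2 := h.measureReal_deviationEvent_le (phaseStart len i) (len i) a
  calc Pr.real E * (len i : ℝ) ≤ 2 * (len i : ℝ) ^ 3 * Real.exp (-a) * len i := by gcongr
    _ = 2 * (len i : ℝ) ^ 4 * Real.exp (-a) := by ring
    _ ≤ 1 := hal

theorem IsRun.integrable_payoff {A : DecisionRule X} (h : IsRun P A Pr ℱ x y) (s : ℕ) :
    Integrable (fun ω => P.payoff (x s ω)) Pr :=
  Integrable.of_bound ((h.measurable_payoff s).mono (ℱ.le s)).aestronglyMeasurable 1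
    (ae_of_all _ fun ω => by
      rw [Real.norm_eq_abs, abs_of_nonneg (P.payoff_mem _).1]; exact (P.payoff_mem _).2)

theorem IsRun.regret_eq {A : DecisionRule X} (h : IsRun P A Pr ℱ x y) (t : ℕ) :
    P.regret Pr y t
      = ∑ s ∈ Finset.range t, ∫ ω, (P.maxReward - P.payoff (x s ω)) ∂Pr := by
  have h1 : ∀ s, ∫ ω, y s ω ∂Pr = ∫ ω, P.payoff (x s ω) ∂Pr := fun s => by
    simpa using h.integral_mul_reward s (g := fun _ => 1) stronglyMeasurable_const (C := 1) (by simp)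
  unfold Instance.regret
  rw [integral_finsetSum _ fun s _ => h.integrable s]
  simp only [integral_sub (integrable_const _) (h.integrable_payoff _), h1, Finset.sum_sub_distrib]
  simp

end Run

/-! ### Summation over doubly exponential phases -/

section DoublyExponential

/-- Doubly exponential phase lengths. -/
def doubleExpLen (i : ℕ) : ℕ := 2 ^ 2 ^ i

theorem doubleExpLen_pos (i : ℕ) : 0 < doubleExpLen i := by unfold doubleExpLen; positivity

theorem logb_doubleExpLen (i : ℕ) : Real.logb 2 (doubleExpLen i) = 2 ^ i := by
  unfold doubleExpLen
  push_cast
  rw [Real.logb_pow]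
  simp

/-- With a = 5 · 2^i and length l ≤ e^(2^i), e^a ≥ l⁵ ≥ 2l⁴. This choice of a gives κ = 32 · 5 =
160. -/
theorem two_mul_doubleExpLen_pow_mul_exp_le (i : ℕ) :
    2 * (doubleExpLen i : ℝ) ^ 4 * Real.exp (-(5 * 2 ^ i)) ≤ 1 := by
  set l : ℝ := (doubleExpLen i : ℝ) with hl
  have hl2 : 2 ≤ l := by
    have : 2 ≤ doubleExpLen i := by
      unfold doubleExpLen
      calc 2 = 2 ^ 1 := rfl
        _ ≤ 2 ^ 2 ^ i := Nat.pow_le_pow_right (by norm_num) Nat.one_le_two_pow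
    rw [hl]; exact_mod_cast this
  have h1 : l ^ 5 ≤ Real.exp (5 * 2 ^ i) := by
    have h2 : l ≤ Real.exp (2 ^ i) := by
      have h3 : (2 : ℝ) ≤ Real.exp 1 := by
        have := Real.add_one_le_exp (1 : ℝ); linarith
      calc l = 2 ^ 2 ^ i := by rw [hl]; unfold doubleExpLen; push_cast; rfl
        _ ≤ Real.exp 1 ^ 2 ^ i := by gcongr
        _ = Real.exp (2 ^ i) := by rw [← Real.exp_nat_mul]; push_cast; rw [mul_one]
    calc l ^ 5 ≤ Real.exp (2 ^ i) ^ 5 := by gcongr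
      _ = _ := by rw [← Real.exp_nat_mul]; push_cast; rfl
  rw [Real.exp_neg, ← div_eq_mul_inv, div_le_one (Real.exp_pos _)]
  refine le_trans ?_ h1
  have : 0 < l ^ 4 := by positivity
  nlinarith

/-- For the least such I > 0 the phase before it is completed before t, so 2^(2^(I-1)) ≤ t. -/
theorem exists_phase_bound {t : ℕ} (ht : 2 ≤ t) :
    ∃ I, t ≤ phaseStart doubleExpLen (I + 1) ∧ (2 : ℝ) ^ I ≤ 2 * Real.logb 2 t := by
  have hex : ∃ I, t ≤ phaseStart doubleExpLen (I + 1) :=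
    ⟨t, (Nat.le_succ t).trans (phaseStart_strictMono doubleExpLen_pos).le_apply⟩
  classical
  refine ⟨Nat.find hex, Nat.find_spec hex, ?_⟩
  have hlog : 1 ≤ Real.logb 2 t := by
    rw [Real.le_logb_iff_rpow_le (by norm_num) (by positivity), Real.rpow_one]
    exact_mod_cast ht
  rcases hI : Nat.find hex with _ | I
  · rw [pow_zero]; linarith
  · have h1 := Nat.find_min hex (m := I) (by omega)
    rw [phaseStart_succ] at h1
    have h2 : 2 ^ 2 ^ I ≤ t := by
      have : doubleExpLen I = 2 ^ 2 ^ I := rfl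
      omega
    have h3 : (2 : ℝ) ^ I ≤ Real.logb 2 t := by
      rw [Real.le_logb_iff_rpow_le (by norm_num) (by positivity)]
      have : ((2 : ℝ) ^ ((2 : ℝ) ^ I)) = ((2 ^ 2 ^ I : ℕ) : ℝ) := by
        push_cast
        rw [← Real.rpow_natCast 2 (2 ^ I)]; push_cast; rfl
      rw [this]; exact_mod_cast h2
    rw [pow_succ]; linarith

theorem sum_Ico_phaseStart (len : ℕ → ℕ) (hlen : ∀ i, 0 < len i) (f : ℕ → ℝ) (I : ℕ) :
    ∑ s ∈ Finset.range (phaseStart len I), f s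
      = ∑ i ∈ Finset.range I, ∑ s ∈ Finset.Ico (phaseStart len i) (phaseStart len (i + 1)), f s := by
  induction I with
  | zero => simp [phaseStart]
  | succ I ih =>
    rw [Finset.sum_range_succ, ← ih, Finset.sum_range_add_sum_Ico]
    exact (phaseStart_strictMono hlen).monotone (Nat.le_succ I)

variable {X : Type u} [MetricSpace X] {O : CoveringOracle X}
  {τ : TieBreak X} {P : Instance X} {Ω : Type v} {x : ℕ → Ω → X} {y : ℕ → Ω → ℝ}
  [mΩ : MeasurableSpace Ω] {Pr : Measure Ω} {ℱ : Filtration ℕ mΩ} [IsProbabilityMeasure Pr]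

theorem IsRun.sum_range_measureReal_layer_le (hX : ∀ x y : X, dist x y ≤ 1)
    (h : IsRun P (zoomingRule 160 doubleExpLen O τ) Pr ℱ x y) {β : ℝ} (hβ0 : 0 ≤ β)
    {ρ : ℝ} (hρ : ρ ∈ Ioc (0 : ℝ) 1) {n : ℕ} {S : Fin n → Set X}
    (hS : ∀ j, Metric.ediam (S j) ≤ ENNReal.ofReal (ρ / 8)) (hcov : P.layer ρ ⊆ ⋃ j, S j)
    (hβ : ∀ v ∈ P.layer ρ, max (P.maxReward - P.payoff v) (1 - P.payoff v) * ρ ^ β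
      ≤ 4 * (P.maxReward - P.payoff v) ^ 2) {t : ℕ} (ht : 2 ≤ t) :
    ∑ s ∈ Finset.range t, Pr.real {ω | x s ω ∈ P.layer ρ}
      ≤ n * (276480 * Real.logb 2 t * ρ ^ (-β)) := by
  have hlog : 1 ≤ Real.logb 2 t := by
    rw [Real.le_logb_iff_rpow_le (by norm_num) (by positivity), Real.rpow_one]
    exact_mod_cast ht
  have hρβ : 0 < ρ ^ (-β) := Real.rpow_pos_of_pos hρ.1 _
  -- An empty layer may be covered by n = 0 sets, and then the extra 1 per phase could not be
  -- absorbed into n * K.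
  rcases (P.layer ρ).eq_empty_or_nonempty with he | ⟨v₀, hv₀⟩
  · have : ∀ s, Pr.real {ω | x s ω ∈ P.layer ρ} = 0 := fun s => by rw [he]; simp
    simp only [this, Finset.sum_const_zero]
    positivity
  have hn1 : (1 : ℝ) ≤ n := by
    obtain ⟨j, -⟩ := mem_iUnion.1 (hcov hv₀)
    have : 0 < n := Fin.pos j
    exact_mod_cast this
  have hρ1 : 1 ≤ ρ ^ (-β) := Real.one_le_rpow_of_pos_of_le_one_of_nonpos hρ.1 hρ.2 (by linarith)
  obtain ⟨I, hI1, hI2⟩ := exists_phase_bound ht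
  have hphase : ∀ i, ∑ s ∈ Finset.Ico (phaseStart doubleExpLen i) (phaseStart doubleExpLen (i + 1)),
      Pr.real {ω | x s ω ∈ P.layer ρ} ≤ n * (69120 * ρ ^ (-β)) * 2 ^ i := by
    intro i
    have h2i : (1 : ℝ) ≤ 2 ^ i := one_le_pow₀ (by norm_num)
    -- 34560 = 54 · 160 · 4, the last factor coming from `hβ`. Absorbing the extra 1 doubles it to
    -- 69120, and the geometric sum over phases, at most 4 log₂ t, gives 276480.
    have h1 := h.sum_measureReal_layer_le hX doubleExpLen_pos (i := i) (a := 5 * 2 ^ i)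
      (by linarith) (by rw [logb_doubleExpLen]; ring) (two_mul_doubleExpLen_pow_mul_exp_le i) hρ.1
      hS hcov (K := 34560 * 2 ^ i * ρ ^ (-β)) (by positivity) (by
        intro v hv
        rw [logb_doubleExpLen]
        have h2 := mul_le_mul_of_nonneg_right (hβ v hv) hρβ.le
        rw [mul_assoc, ← Real.rpow_add hρ.1, add_neg_cancel, Real.rpow_zero, mul_one] at h2
        calc 54 * (160 * 2 ^ i) * max (P.maxReward - P.payoff v) (1 - P.payoff v)
            ≤ 54 * (160 * 2 ^ i) * (4 * (P.maxReward - P.payoff v) ^ 2 * ρ ^ (-β)) := by gcongr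
          _ = _ := by ring)
    refine h1.trans ?_
    have h3 : (1 : ℝ) ≤ n * (34560 * 2 ^ i * ρ ^ (-β)) := by
      have : (1 : ℝ) ≤ 2 ^ i * ρ ^ (-β) := one_le_mul_of_one_le_of_one_le h2i hρ1
      have : (1 : ℝ) ≤ 34560 * 2 ^ i * ρ ^ (-β) := by nlinarith
      exact one_le_mul_of_one_le_of_one_le hn1 this
    nlinarith
  calc ∑ s ∈ Finset.range t, Pr.real {ω | x s ω ∈ P.layer ρ}
      ≤ ∑ s ∈ Finset.range (phaseStart doubleExpLen (I + 1)), Pr.real {ω | x s ω ∈ P.layer ρ} :=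
        Finset.sum_le_sum_of_subset_of_nonneg (Finset.range_subset_range.2 hI1)
          fun _ _ _ => measureReal_nonneg
    _ = _ := sum_Ico_phaseStart _ doubleExpLen_pos _ _
    _ ≤ ∑ i ∈ Finset.range (I + 1), n * (69120 * ρ ^ (-β)) * 2 ^ i :=
        Finset.sum_le_sum fun i _ => hphase i
    _ = n * (69120 * ρ ^ (-β)) * (2 ^ (I + 1) - 1) := by
        rw [← Finset.mul_sum, geom_sum_eq (by norm_num)]; norm_num
    _ ≤ n * (69120 * ρ ^ (-β)) * (4 * Real.logb 2 t) := by
        gcongr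
        rw [pow_succ]; linarith
    _ = _ := by ring

end DoublyExponential

/-! ### Zooming dimension and dyadic layers -/

section ZoomingCover

variable {X : Type u} [MetricSpace X] {P : Instance X} {c d : ℝ}

/-- The infimum is attained: for fixed r the least number of covering sets is at most c r^(-d') for
every d' > d, and the bound passes to the limit d' → d. -/
theorem Instance.zoomingCover_of_zoomingDim_le (hc : 0 < c) (h : P.zoomingDim c ≤ (d : EReal)) :
    P.ZoomingCover c d := by
  classical
  intro r hr
  let Q : ℕ → Prop := fun n => ∃ S : Fin n → Set X,
    (∀ i, Metric.ediam (S i) ≤ ENNReal.ofReal (r / 8)) ∧ P.layer r ⊆ ⋃ i, S i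
  have hQ : ∀ d' : ℝ, d < d' → ∃ n : ℕ, (n : ℝ) ≤ c * r ^ (-d') ∧ Q n := by
    intro d' hd'
    have h1 : P.zoomingDim c < (d' : EReal) := h.trans_lt (by exact_mod_cast hd')
    obtain ⟨e, ⟨d'', hcov, rfl⟩, he⟩ := sInf_lt_iff.1 h1
    have hd'' : d'' < d' := by exact_mod_cast he
    obtain ⟨n, hn, hQn⟩ := hcov r hr
    refine ⟨n, hn.trans ?_, hQn⟩
    gcongr ?_ * ?_
    exact Real.rpow_le_rpow_of_exponent_ge hr.1 hr.2 (by linarith)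
  have hex : ∃ n, Q n := by
    obtain ⟨n, -, hn⟩ := hQ (d + 1) (by linarith)
    exact ⟨n, hn⟩
  refine ⟨Nat.find hex, ?_, Nat.find_spec hex⟩
  have hlim : Filter.Tendsto (fun k : ℕ => c * r ^ (-(d + 1 / ((k : ℝ) + 1)))) Filter.atTop
      (nhds (c * r ^ (-(d + 0)))) := by
    refine Filter.Tendsto.const_mul c ?_
    refine ((Real.continuous_const_rpow hr.1.ne').tendsto _).comp ?_
    exact (tendsto_const_nhds.add tendsto_one_div_add_atTop_nhds_zero_nat).neg
  rw [add_zero] at hlim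
  refine ge_of_tendsto' hlim fun k => ?_
  have hpos : (0 : ℝ) < 1 / ((k : ℝ) + 1) := by positivity
  obtain ⟨n, hn, hQn⟩ := hQ (d + 1 / ((k : ℝ) + 1)) (by linarith)
  refine le_trans ?_ hn
  exact_mod_cast Nat.find_min' hex hQn

theorem Instance.gap_mem [Nonempty X] (x : X) : P.maxReward - P.payoff x ∈ Icc (0 : ℝ) 1 :=
  ⟨sub_nonneg.2 (P.payoff_le x), by linarith [P.maxReward_le, (P.payoff_mem x).1]⟩

/-- The layer at the gap of x contains x, so its cover has at least one set. This relates c to the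
gaps that occur. -/
theorem Instance.ZoomingCover.gap_rpow_le (h : P.ZoomingCover c d) [Nonempty X] {x : X}
    (hx : 0 < P.maxReward - P.payoff x) : (P.maxReward - P.payoff x) ^ d ≤ c := by
  obtain ⟨n, hn, S, -, hcov⟩ := h _ ⟨hx, (P.gap_mem x).2⟩
  have hmem : x ∈ P.layer (P.maxReward - P.payoff x) := ⟨by linarith, le_rfl⟩
  obtain ⟨j, -⟩ := mem_iUnion.1 (hcov hmem)
  have hn1 : (1 : ℝ) ≤ n := by exact_mod_cast Fin.pos j
  have h1 := hn1.trans hn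
  rw [Real.rpow_neg hx.le, ← div_eq_mul_inv, le_div_iff₀ (Real.rpow_pos_of_pos hx d)] at h1
  linarith

/-- The dyadic scales `δ, 2δ, 4δ, …`, cut off at `1`. -/
noncomputable def scale (δ : ℝ) (j : ℕ) : ℝ := min 1 (δ * 2 ^ j)

theorem scale_mem {δ : ℝ} (hδ : δ ∈ Ioc (0 : ℝ) 1) (j : ℕ) : scale δ j ∈ Icc δ 1 := by
  refine ⟨le_min hδ.2 ?_, min_le_left _ _⟩
  exact le_mul_of_one_le_right hδ.1.le (one_le_pow₀ (by norm_num))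

theorem Instance.exists_mem_layer_scale [Nonempty X] {δ : ℝ} (hδ : δ ∈ Ioc (0 : ℝ) 1) {J : ℕ} {x : X}
    (hJ : P.maxReward - P.payoff x ≤ δ * 2 ^ J) (hx : δ / 2 < P.maxReward - P.payoff x) :
    ∃ j ∈ Finset.range (J + 1), x ∈ P.layer (scale δ j) := by
  classical
  have h1 := (P.gap_mem x).2
  have hex : ∃ j, P.maxReward - P.payoff x ≤ scale δ j := ⟨J, le_min h1 hJ⟩
  refine ⟨Nat.find hex, ?_, ?_, Nat.find_spec hex⟩
  · exact Finset.mem_range.2 (Nat.lt_succ_of_le (Nat.find_min' hex (le_min h1 hJ)))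
  · rcases hj : Nat.find hex with _ | j
    · have : scale δ 0 = δ := by simp [scale, hδ.2]
      rwa [this]
    · have h2 := not_le.1 (Nat.find_min hex (m := j) (by omega))
      have h3 : δ * 2 ^ j < P.maxReward - P.payoff x := by
        rcases min_lt_iff.1 h2 with h3 | h3
        · linarith
        · exact h3
      have h4 : scale δ (j + 1) ≤ δ * 2 ^ (j + 1) := min_le_right _ _
      rw [pow_succ] at h4
      linarith

end ZoomingCover

/-! ### Regret bounds and the choice of the cut-off scale -/

section Regret

variable {X : Type u} [MetricSpace X] {O : CoveringOracle X}
  {τ : TieBreak X} {P : Instance X} {Ω : Type v} {x : ℕ → Ω → X} {y : ℕ → Ω → ℝ}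
  [mΩ : MeasurableSpace Ω] {Pr : Measure Ω} {ℱ : Filtration ℕ mΩ} [IsProbabilityMeasure Pr]

theorem IsRun.regret_le_of_gap_le {A : DecisionRule X} (h : IsRun P A Pr ℱ x y) {r : ℝ}
    (hr : ∀ x, P.maxReward - P.payoff x ≤ r) (t : ℕ) : P.regret Pr y t ≤ t * r := by
  rw [h.regret_eq]
  calc _ ≤ ∑ s ∈ Finset.range t, r := by
        refine Finset.sum_le_sum fun s _ => ?_
        calc _ ≤ ∫ _, r ∂Pr := integral_mono ((integrable_const _).sub (h.integrable_payoff s))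
              (integrable_const _) fun ω => hr _
          _ = r := by simp
    _ = t * r := by simp

theorem IsRun.regret_le_sum_scale [Nonempty X] {A : DecisionRule X} (h : IsRun P A Pr ℱ x y)
    {δ : ℝ} (hδ : δ ∈ Ioc (0 : ℝ) 1) {J : ℕ} (hJ : ∀ x, P.maxReward - P.payoff x ≤ δ * 2 ^ J)
    (t : ℕ) : P.regret Pr y t ≤ δ / 2 * t + ∑ j ∈ Finset.range (J + 1), scale δ j *
      ∑ s ∈ Finset.range t, Pr.real {ω | x s ω ∈ P.layer (scale δ j)} := by
  classical
  have hsc : ∀ j, 0 ≤ scale δ j := fun j => hδ.1.le.trans (scale_mem hδ j).1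
  have hpt : ∀ p : X, P.maxReward - P.payoff p
      ≤ δ / 2 + ∑ j ∈ Finset.range (J + 1), scale δ j * (P.layer (scale δ j)).indicator 1 p := by
    intro p
    have hnn : ∀ j ∈ Finset.range (J + 1),
        0 ≤ scale δ j * (P.layer (scale δ j)).indicator (1 : X → ℝ) p := fun j _ =>
      mul_nonneg (hsc j) (indicator_nonneg (fun _ _ => zero_le_one) _)
    by_cases hp : P.maxReward - P.payoff p ≤ δ / 2
    · linarith [Finset.sum_nonneg hnn]
    · obtain ⟨j, hj, hpj⟩ := P.exists_mem_layer_scale hδ (hJ p) (not_le.1 hp)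
      have h1 := Finset.single_le_sum hnn hj
      rw [indicator_of_mem hpj, Pi.one_apply, mul_one] at h1
      linarith [hpj.2, hδ.1]
  have hind : ∀ s j, Integrable (fun ω => scale δ j *
      (P.layer (scale δ j)).indicator (1 : X → ℝ) (x s ω)) Pr := fun s j =>
    ((integrable_const (1 : ℝ)).indicator (h.measurableSet_layer (scale δ j) s)).const_mul _
  have hone : ∀ s, ∫ ω, (P.maxReward - P.payoff (x s ω)) ∂Pr ≤ δ / 2 +
      ∑ j ∈ Finset.range (J + 1), scale δ j * Pr.real {ω | x s ω ∈ P.layer (scale δ j)} := by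
    intro s
    have hsum := integrable_finsetSum (Finset.range (J + 1)) fun j _ => hind s j
    refine (integral_mono ((integrable_const _).sub (h.integrable_payoff s))
      ((integrable_const (δ / 2)).add hsum) fun ω => hpt (x s ω)).trans ?_
    simp only [Pi.add_apply]
    rw [integral_add (integrable_const _) hsum, integral_finsetSum _ fun j _ => hind s j]
    simp only [integral_const, probReal_univ, smul_eq_mul, one_mul]
    refine add_le_add_right (Finset.sum_le_sum fun j _ => ?_) _
    rw [integral_const_mul]
    refine mul_le_mul_of_nonneg_left (le_of_eq ?_) (hsc j)
    have := integral_indicator_const (μ := Pr) (1 : ℝ) (h.measurableSet_layer (scale δ j) s)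
    rw [smul_eq_mul, mul_one] at this
    exact this
  rw [h.regret_eq]
  refine (Finset.sum_le_sum fun s _ => hone s).trans (le_of_eq ?_)
  rw [Finset.sum_add_distrib, Finset.sum_comm]
  simp only [Finset.sum_const, Finset.card_range, nsmul_eq_mul, Finset.mul_sum]
  ring

/-- The gaps and the expected losses satisfy the inequality that makes the relative confidence
radius as good as a radius of order `n ^ (-1 / β)`. -/
def Instance.GapCondition (P : Instance X) (β : ℝ) : Prop :=
  ∀ ρ ∈ Ioc (0 : ℝ) 1, ∀ v ∈ P.layer ρ,
    max (P.maxReward - P.payoff v) (1 - P.payoff v) * ρ ^ β ≤ 4 * (P.maxReward - P.payoff v) ^ 2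

theorem Instance.gapCondition_two [Nonempty X] (P : Instance X) : P.GapCondition 2 := by
  intro ρ hρ v hv
  have h1 : max (P.maxReward - P.payoff v) (1 - P.payoff v) ≤ 1 :=
    max_le (P.gap_mem v).2 (by linarith [(P.payoff_mem v).1])
  rw [Real.rpow_two]
  have h2 : ρ ^ 2 ≤ 4 * (P.maxReward - P.payoff v) ^ 2 := by nlinarith [hv.1, hρ.1]
  exact (mul_le_of_le_one_left (sq_nonneg _) h1).trans h2

/-- If μ* = 1, the expected loss equals the gap, so one factor of the gap cancels and the power of ρ
drops from 2 to 1. -/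
theorem Instance.gapCondition_one [Nonempty X] (P : Instance X) (hP : P.maxReward = 1) :
    P.GapCondition 1 := by
  intro ρ hρ v hv
  have h0 := (P.gap_mem v).1
  have h1 := hv.1
  rw [hP] at h0 h1 ⊢
  rw [max_self, Real.rpow_one]
  nlinarith

/-- A scale ρ contributes ρ · cρ^(-d) · ρ^(-β) log t up to constants. The condition `hgap` ensures
that at most 3 log₂ t doublings of δ reach every gap. Finally log₂ t ≤ 2 log t gives 3317760 =
276480 · 3 · 4. -/
theorem IsRun.regret_le_of_zoomingCover [Nonempty X] (hX : ∀ x y : X, dist x y ≤ 1)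
    (h : IsRun P (zoomingRule 160 doubleExpLen O τ) Pr ℱ x y) {c d β : ℝ} (hc : 0 < c)
    (hcov : P.ZoomingCover c d) (hβ0 : 0 ≤ β) (hβ : P.GapCondition β) {t : ℕ} (ht : 2 ≤ t)
    {δ W : ℝ} (hδ : δ ∈ Ioc (0 : ℝ) 1) (hgap : ∀ x, P.maxReward - P.payoff x ≤ t * δ)
    (hW : ∀ ρ ∈ Icc δ 1, ρ ^ (1 - (d + β)) ≤ W) :
    P.regret Pr y t ≤ δ / 2 * t + 3317760 * c * Real.log t ^ 2 * W := by
  set L := Real.logb 2 t with hL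
  have ht0 : (0 : ℝ) < t := by positivity
  have hL1 : 1 ≤ L := by
    rw [hL, Real.le_logb_iff_rpow_le (by norm_num) ht0, Real.rpow_one]
    exact_mod_cast ht
  have hW0 : 0 ≤ W := (Real.rpow_nonneg hδ.1.le _).trans (hW δ ⟨le_rfl, hδ.2⟩)
  have htJ : (t : ℝ) ≤ 2 ^ ⌈L⌉₊ := by
    rw [← Real.rpow_natCast, ← Real.logb_le_iff_le_rpow (by norm_num) ht0]
    exact Nat.le_ceil _
  have hJ : ((⌈L⌉₊ + 1 : ℕ) : ℝ) ≤ 3 * L := by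
    have := (Nat.ceil_lt_add_one (by linarith : 0 ≤ L)).le
    push_cast; linarith
  have hgap' : ∀ x, P.maxReward - P.payoff x ≤ δ * 2 ^ ⌈L⌉₊ := fun x =>
    (hgap x).trans (by rw [mul_comm]; exact mul_le_mul_of_nonneg_left htJ hδ.1.le)
  refine (h.regret_le_sum_scale hδ hgap' t).trans (add_le_add_right ?_ _)
  have hterm : ∀ j ∈ Finset.range (⌈L⌉₊ + 1), scale δ j *
      ∑ s ∈ Finset.range t, Pr.real {ω | x s ω ∈ P.layer (scale δ j)}
        ≤ 276480 * c * L * W := by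
    intro j _
    set ρ := scale δ j
    have hρ1 := scale_mem hδ j
    have hρ : ρ ∈ Ioc (0 : ℝ) 1 := ⟨hδ.1.trans_le hρ1.1, hρ1.2⟩
    obtain ⟨n, hn, S, hS, hS'⟩ := hcov ρ hρ
    have h1 := h.sum_range_measureReal_layer_le hX hβ0 hρ hS hS' (hβ ρ hρ) ht
    have hρβ : 0 < ρ ^ (-β) := Real.rpow_pos_of_pos hρ.1 _
    calc _ ≤ ρ * (n * (276480 * L * ρ ^ (-β))) := mul_le_mul_of_nonneg_left h1 hρ.1.le
      _ ≤ ρ * (c * ρ ^ (-d) * (276480 * L * ρ ^ (-β))) := by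
          have := hρ.1.le
          gcongr
      _ = 276480 * c * L * (ρ ^ (1 : ℝ) * ρ ^ (-d) * ρ ^ (-β)) := by rw [Real.rpow_one]; ring
      _ = 276480 * c * L * ρ ^ (1 - (d + β)) := by
          rw [← Real.rpow_add hρ.1, ← Real.rpow_add hρ.1]; ring_nf
      _ ≤ 276480 * c * L * W := by
          have := hW ρ hρ1
          gcongr
  refine (Finset.sum_le_sum hterm).trans ?_
  rw [Finset.sum_const, Finset.card_range, nsmul_eq_mul]
  have hLlog : L ≤ 2 * Real.log t := by
    have h2 : (1 / 2 : ℝ) ≤ Real.log 2 := by linarith [Real.log_two_gt_d9]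
    rw [hL, Real.logb, div_le_iff₀ (by linarith)]
    have : 0 ≤ Real.log t := Real.log_nonneg (by exact_mod_cast (by omega : 1 ≤ t))
    nlinarith
  calc ((⌈L⌉₊ + 1 : ℕ) : ℝ) * (276480 * c * L * W) ≤ 3 * L * (276480 * c * L * W) := by gcongr
    _ = 829440 * c * W * L ^ 2 := by ring
    _ ≤ 829440 * c * W * (2 * Real.log t) ^ 2 := by gcongr
    _ = _ := by ring

theorem isGoodOn_zoomingRule [Nonempty X] (hX : ∀ x y : X, dist x y ≤ 1) (O : CoveringOracle X)
    (τ : TieBreak X) {β : ℝ} (hβ1 : 1 ≤ β) (hβ : P.GapCondition β) :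
    IsGoodOn.{u, v} (zoomingRule 160 doubleExpLen O τ) P β 6635520 := by
  intro c d hc hdim Ω _ Pr _ ℱ x y h t ht
  have hcov := P.zoomingCover_of_zoomingDim_le hc hdim
  have ht0 : (0 : ℝ) < t := by positivity
  have ht1 : (1 : ℝ) ≤ t := by exact_mod_cast (by omega : 1 ≤ t)
  have hlog : (1 / 2 : ℝ) ≤ Real.log t := by
    have h2 : (1 / 2 : ℝ) ≤ Real.log 2 := by linarith [Real.log_two_gt_d9]
    exact h2.trans (Real.log_le_log (by norm_num) (by exact_mod_cast ht))
  have hlog2 : (1 / 4 : ℝ) ≤ Real.log t ^ 2 := by nlinarith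
  constructor
  · intro he
    set e := d + β with he_def
    have he0 : 0 < e := by linarith
    set B := c * 6635520 * Real.log t ^ 2 with hB
    have hB0 : 0 < B := by positivity
    -- With this δ the target is t δ. Since 6635520 is twice 3317760, the small gaps and the layers
    -- contribute δ t / 2 each. If δ ≥ 1 the claim is trivial, all gaps being at most 1.
    set δ := (B / t) ^ (1 / e) with hδ
    have hδ0 : 0 < δ := Real.rpow_pos_of_pos (by positivity) _
    have hδe : δ ^ e = B / t := by
      rw [hδ, ← Real.rpow_mul (by positivity), one_div_mul_cancel he0.ne', Real.rpow_one]
    have htarget : B ^ (1 / e) * (t : ℝ) ^ (1 - 1 / e) = t * δ := by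
      rw [hδ, Real.div_rpow hB0.le ht0.le, Real.rpow_sub ht0, Real.rpow_one]
      ring
    rw [htarget]
    rcases le_or_gt 1 δ with h1 | h1
    · refine (h.regret_le_of_gap_le (fun x => (P.gap_mem x).2) t).trans ?_
      gcongr
    -- By `gap_rpow_le` and β ≥ 0, the e-th power of a gap is at most c ≤ B, while t ≤ t^e because e
    -- > 1.
    have hgap : ∀ x, P.maxReward - P.payoff x ≤ t * δ := by
      intro z
      rcases (P.gap_mem z).1.eq_or_lt with h0 | h0
      · rw [← h0]; positivity
      have h2 := hcov.gap_rpow_le h0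
      set ρ := P.maxReward - P.payoff z
      have h3 : (ρ / t) ^ e ≤ δ ^ e := by
        rw [hδe, Real.div_rpow h0.le ht0.le]
        have h4 : ρ ^ e ≤ B := by
          have h5 : ρ ^ e ≤ ρ ^ d :=
            Real.rpow_le_rpow_of_exponent_ge h0 (P.gap_mem z).2 (by linarith)
          refine (h5.trans h2).trans ?_
          rw [hB]; nlinarith
        have h5 : (t : ℝ) ≤ (t : ℝ) ^ e := by
          conv_lhs => rw [← Real.rpow_one (t : ℝ)]
          exact Real.rpow_le_rpow_of_exponent_le ht1 he.le
        gcongr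
      have h4 := (Real.rpow_le_rpow_iff (by positivity) hδ0.le he0).1 h3
      rw [div_le_iff₀ ht0] at h4
      linarith
    have h2 := h.regret_le_of_zoomingCover hX hc hcov (by linarith) hβ ht (W := δ ^ (1 - e))
      ⟨hδ0, h1.le⟩ hgap (fun ρ hρ => Real.rpow_le_rpow_of_nonpos hδ0 hρ.1 (by linarith))
    have hW : δ ^ (1 - e) = δ * t / B := by
      rw [Real.rpow_sub hδ0, Real.rpow_one, hδe]; field_simp
    have h3 : 3317760 * c * Real.log t ^ 2 * δ ^ (1 - e) = δ * t / 2 := by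
      rw [hW, hB]
      field_simp
      norm_num
    rw [h3] at h2
    linarith
  · intro he
    by_cases hz : ∀ z, P.maxReward - P.payoff z ≤ 0
    · refine (h.regret_le_of_gap_le hz t).trans ?_
      rw [mul_zero]; positivity
    · push Not at hz
      obtain ⟨z, hz⟩ := hz
      -- Here d ≤ 1 - β ≤ 0, so a positive gap, being at most 1, has d-th power at least 1. This
      -- lets c c₀ log² t absorb the 1/2 left by the cut-off δ = 1 / t.
      have hc1 : 1 ≤ c := (Real.one_le_rpow_of_pos_of_le_one_of_nonpos hz (P.gap_mem z).2
        (by linarith)).trans (hcov.gap_rpow_le hz)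
      have h2 := h.regret_le_of_zoomingCover hX hc hcov (by linarith) hβ ht (W := 1) (δ := 1 / t)
        ⟨by positivity, (div_le_one ht0).2 ht1⟩
        (fun z => by rw [mul_one_div_cancel ht0.ne']; exact (P.gap_mem z).2)
        (fun ρ hρ => Real.rpow_le_one ((by positivity : (0 : ℝ) ≤ 1 / t).trans hρ.1) hρ.2
          (by linarith))
      have h3 : 1 / (t : ℝ) / 2 * t = 1 / 2 := by field_simp
      rw [h3] at h2
      nlinarith [mul_le_mul hc1 hlog2 (by norm_num) hc.le]

end Regret

end LipschitzBandit

theorem mainTheorem5 :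
    ∃ (κ c₀ : ℝ) (len : ℕ → ℕ), 0 < κ ∧ 0 < c₀ ∧ (∀ i, 0 < len i) ∧
      ∀ (X : Type u) [MetricSpace X] [Nonempty X], (∀ x y : X, dist x y ≤ 1) →
        ∀ (O : LipschitzBandit.CoveringOracle X) (τ : LipschitzBandit.TieBreak X)
          (P : LipschitzBandit.Instance X),
          LipschitzBandit.IsGoodOn.{u, v} (LipschitzBandit.zoomingRule κ len O τ) P 2 c₀ ∧
          (P.maxReward = 1 →
            LipschitzBandit.IsGoodOn.{u, v} (LipschitzBandit.zoomingRule κ len O τ) P 1 c₀) :=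
  ⟨160, 6635520, LipschitzBandit.doubleExpLen, by norm_num, by norm_num,
    LipschitzBandit.doubleExpLen_pos, fun _ _ _ hX O τ P =>
      ⟨LipschitzBandit.isGoodOn_zoomingRule hX O τ (by norm_num) P.gapCondition_two, fun hP =>
        LipschitzBandit.isGoodOn_zoomingRule hX O τ le_rfl (P.gapCondition_one hP)⟩⟩
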